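/- Let $\mathcal A$ be a unital $C^*$-algebra, let $\mathcal B$ be a von Neumann algebra, faithfully embedded in $\mathcal B(G)$ for a Hilbert space $G$, and let $\phi_1,\phi_2:\mathcal A\to\mathcal B$ be unital completely positive maps. A joint representation tuple of $(\phi_1,\phi_2)$ is $(\mathcal E,\sigma_1,\sigma_2,x)$, where $\mathcal E$ is a right Hilbert $\mathcal B$-module, $\sigma_1,\sigma_2:\mathcal A\to\mathcal B^a(\mathcal E)$ are unital $*$-homomorphisms into the $C^*$-algebra of bounded adjointable operators on $\mathcal E$, and $x\in\mathcal E$ satisfies $\langle x,x\rangle=1$ and $\phi_i(a)=\langle x,\sigma_i(a)x\rangle$ for all $a\in\mathcal A$, $i=1,2$. The representation metric is $$\gamma(\phi_1,\phi_2)=\inf\|\sigma_1-\sigma_2\|_{cb},$$ the infimum being over all joint representation tuples. Let $\mathcal A*\mathcal A$ be the full (unital) free product, with canonical maps $\rho_1,\rho_2:\mathcal A\to\mathcal A*\mathcal A$, and let $$K(\phi_1,\phi_2)=\{\phi:\mathcal A*\mathcal A\to\mathcal B \text{ completely positive}:\ \phi\circ\rho_1=\phi_1,\ \phi\circ\rho_2=\phi_2\}.$$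 A minimal Stinespring module of $\phi\in K(\phi_1,\phi_2)$ is a triple $(\mathcal E,\sigma,x)$ with $\mathcal E$ a Hilbert $\mathcal B$-module, $\sigma:\mathcal A*\mathcal A\to\mathcal B^a(\mathcal E)$ a unital $*$-homomorphism and $x\in\mathcal E$, such that $\phi(c)=\langle x,\sigma(c)x\rangle$ for all $c$, and such that $\operatorname{span}\,\sigma(\mathcal A*\mathcal A)x\mathcal B$ is dense in $\mathcal E$: either $\mathcal E$ is a von Neumann $\mathcal B$-module (strongly closed in $\mathcal B(G,\mathcal E\odot G)$) and the span is strongly dense, or $\mathcal E$ is any Hilbert $\mathcal B$-module and the span is norm dense. Theorem. There is a $\phi\in K(\phi_1,\phi_2)$ that has minimal Stinespring modules of both kinds and such that, for every minimal Stinespring module $(\mathcal E,\sigma,x)$ of $\phi$ of either kind, with $\sigma_i=\sigma\circ\rho_i$, $$\gamma(\phi_1,\phi_2)=\|\sigma_1-\sigma_2\|_{cb}.$$ That is, the infimum defining $\gamma(\phi_1,\phi_2)$ is attained at $\phi$. -/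

import Mathlib

open MulOpposite UniformSpace
open scoped ENNReal CStarAlgebra
universe u

/-! ### The full free product -/
section FreeProduct

variable (A : Type u) [CStarAlgebra A]

/-- The algebraic unital free product `A ∘ A` of a unital C⋆-algebra with itself
(finite linear combinations of words in two copies of `A`, with the units identified). -/
def AlgFreeProduct : Type u := LinearAlgebra.FreeProduct ℂ (fun _ : Fin 2 => A)

namespace AlgFreeProduct

noncomputable instance : Ring (AlgFreeProduct A) :=
  inferInstanceAs (Ring (LinearAlgebra.FreeProduct ℂ (fun _ : Fin 2 => A)))

noncomputable instance : Algebra ℂ (AlgFreeProduct A) :=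
  inferInstanceAs (Algebra ℂ (LinearAlgebra.FreeProduct ℂ (fun _ : Fin 2 => A)))

variable {A}

/-- The two canonical copies of `A` in `A ∘ A`. -/
noncomputable def incl (i : Fin 2) : A →ₐ[ℂ] AlgFreeProduct A :=
  LinearAlgebra.FreeProduct.ι ℂ (fun _ : Fin 2 => A) i

/-- The universal property of the algebraic free product. -/
noncomputable def lift {R : Type*} [Ring R] [Algebra ℂ R] (f : Fin 2 → A →ₐ[ℂ] R) :
    AlgFreeProduct A →ₐ[ℂ] R :=
  LinearAlgebra.FreeProduct.lift ℂ (fun _ : Fin 2 => A) (fun {i} => f i)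

theorem lift_incl {R : Type*} [Ring R] [Algebra ℂ R] (f : Fin 2 → A →ₐ[ℂ] R) (i : Fin 2) (a : A) :
    lift f (incl i a) = f i a := 
  DFunLike.congr_fun (LinearAlgebra.FreeProduct.lift_comp_ι ℂ (fun _ : Fin 2 => A)
    (fun {i} => f i)) a

theorem hom_ext {R : Type*} [Ring R] [Algebra ℂ R] {f g : AlgFreeProduct A →ₐ[ℂ] R}
    (h : ∀ i a, f (incl i a) = g (incl i a)) : f = g := by
  have hf := LinearAlgebra.FreeProduct.lift_unique ℂ (fun _ : Fin 2 => A)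
    (fun {i} => g.comp (incl i)) f (fun i => AlgHom.ext (h i))
  have hg := LinearAlgebra.FreeProduct.lift_unique ℂ (fun _ : Fin 2 => A)
    (fun {i} => g.comp (incl i)) g (fun i => rfl)
  exact hf.trans hg.symm


theorem induction {p : AlgFreeProduct A → Prop} (hC : ∀ r : ℂ, p (algebraMap ℂ _ r))
    (hi : ∀ i a, p (incl i a)) (hadd : ∀ c d, p c → p d → p (c + d))
    (hmul : ∀ c d, p c → p d → p (c * d)) (c : AlgFreeProduct A) : p c := by
  let S : Subalgebra ℂ (AlgFreeProduct A) :=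
    { carrier := {c | p c}
      mul_mem' := fun hc hd => hmul _ _ hc hd
      add_mem' := fun hc hd => hadd _ _ hc hd
      algebraMap_mem' := hC }
  have h : S.val.comp (lift fun i => (incl i).codRestrict S (hi i)) = AlgHom.id ℂ _ := by
    refine hom_ext fun i a => ?_
    rw [AlgHom.comp_apply, lift_incl]
    rfl
  have := DFunLike.congr_fun h c
  rw [AlgHom.comp_apply, AlgHom.id_apply] at this
  rw [← this]
  exact (lift (fun i => (incl i).codRestrict S (hi i)) c).2

/-- The conjugate complex algebra structure on the opposite of `A ∘ A`. -/
noncomputable abbrev conjAlgebra : Algebra ℂ (AlgFreeProduct A)ᵐᵒᵖ :=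
  ((algebraMap ℂ (AlgFreeProduct A)ᵐᵒᵖ).comp (starRingEnd ℂ)).toAlgebra'
    fun r x => Algebra.commutes (starRingEnd ℂ r) x

/-- The map `c ↦ op (c⋆)`, determined by reversing words and taking adjoints of letters. -/
noncomputable def starHom : AlgFreeProduct A →+* (AlgFreeProduct A)ᵐᵒᵖ :=
  letI : Algebra ℂ (AlgFreeProduct A)ᵐᵒᵖ := conjAlgebra
  (lift fun i : Fin 2 =>
    ({ toFun := fun a => op (incl i (star a))
       map_one' := by simp
       map_mul' := fun a b => by simp
       map_zero' := by simp
       map_add' := fun a b => by simp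
       commutes' := fun r => by
        rw [← algebraMap_star_comm, AlgHom.commutes]
        rfl } : A →ₐ[ℂ] (AlgFreeProduct A)ᵐᵒᵖ)).toRingHom

theorem starHom_incl (i : Fin 2) (a : A) : starHom (incl i a) = op (incl i (star a)) :=
  letI : Algebra ℂ (AlgFreeProduct A)ᵐᵒᵖ := conjAlgebra
  lift_incl _ i a

theorem starHom_algebraMap (r : ℂ) :
    starHom (algebraMap ℂ (AlgFreeProduct A) r) = op (algebraMap ℂ _ (starRingEnd ℂ r)) :=
  letI : Algebra ℂ (AlgFreeProduct A)ᵐᵒᵖ := conjAlgebra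
  AlgHom.commutes _ r

noncomputable instance : StarRing (AlgFreeProduct A) where
  star c := unop (starHom c)
  star_involutive c := by
    induction c using induction with
    | hC r => simp [starHom_algebraMap]
    | hi i a => simp [starHom_incl]
    | hadd c d hc hd => simp only [map_add, unop_add] at *; rw [hc, hd]
    | hmul c d hc hd => simp only [map_mul, unop_mul] at *; rw [hc, hd]
  star_mul c d := by simp
  star_add c d := by simp

theorem star_incl (i : Fin 2) (a : A) : star (incl i a) = incl i (star a) :=
  congrArg unop (starHom_incl i a)

instance : StarModule ℂ (AlgFreeProduct A) where
  star_smul r c := by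
    change unop (starHom (r • c)) = star r • unop (starHom c)
    rw [Algebra.smul_def, map_mul, starHom_algebraMap, Algebra.smul_def, unop_mul]
    exact (Algebra.commutes (star r) _).symm

/-- A `*`-representation of `A ∘ A` on a Hilbert space. -/
structure Rep (A : Type u) [CStarAlgebra A] : Type (u + 1) where
  H : Type u
  [normedAddCommGroup : NormedAddCommGroup H]
  [innerProductSpace : InnerProductSpace ℂ H]
  [completeSpace : CompleteSpace H]
  π : AlgFreeProduct A →⋆ₐ[ℂ] (H →L[ℂ] H)

attribute [instance] Rep.normedAddCommGroup Rep.innerProductSpace Rep.completeSpace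

/-- The restriction of a representation of `A ∘ A` to one of the two copies of `A`. -/
noncomputable def Rep.restrict (P : Rep A) (i : Fin 2) : A →⋆ₐ[ℂ] (P.H →L[ℂ] P.H) :=
  { P.π.toAlgHom.comp (incl i) with
    map_star' := fun a => by
      change P.π (incl i (star a)) = star (P.π (incl i a))
      rw [← star_incl, map_star] }

/-- The norm `‖c‖ = sup {‖π(c)‖ : π a representation of A ∘ A on some Hilbert space}`. -/
noncomputable def repNorm (c : AlgFreeProduct A) : ℝ := ⨆ P : Rep A, ‖P.π c‖

theorem bddAbove_rep (c : AlgFreeProduct A) :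
    BddAbove (Set.range fun P : Rep A => ‖P.π c‖) := by
  suffices h : ∃ C, ∀ P : Rep A, ‖P.π c‖ ≤ C by
    obtain ⟨C, hC⟩ := h
    exact ⟨C, by rintro _ ⟨P, rfl⟩; exact hC P⟩
  induction c using induction with
  | hC r =>
    refine ⟨‖r‖, fun P => ?_⟩
    rw [AlgHomClass.commutes, Algebra.algebraMap_eq_smul_one, norm_smul]
    exact mul_le_of_le_one_right (norm_nonneg r) ContinuousLinearMap.norm_id_le
  | hi i a => exact ⟨‖a‖, fun P => NonUnitalStarAlgHom.norm_apply_le (P.restrict i) a⟩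
  | hadd c d hc hd =>
    obtain ⟨C, hC⟩ := hc
    obtain ⟨D, hD⟩ := hd
    refine ⟨C + D, fun P => ?_⟩
    rw [map_add]
    exact (norm_add_le _ _).trans (add_le_add (hC P) (hD P))
  | hmul c d hc hd =>
    obtain ⟨C, hC⟩ := hc
    obtain ⟨D, hD⟩ := hd
    refine ⟨C * D, fun P => ?_⟩
    rw [map_mul]
    exact (norm_mul_le _ _).trans
      (mul_le_mul (hC P) (hD P) (norm_nonneg _) ((norm_nonneg _).trans (hC P)))

theorem le_repNorm (P : Rep A) (c : AlgFreeProduct A) : ‖P.π c‖ ≤ repNorm c :=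
  le_ciSup (bddAbove_rep c) P

theorem repNorm_nonneg (c : AlgFreeProduct A) : 0 ≤ repNorm c :=
  Real.iSup_nonneg fun _ => norm_nonneg _

theorem repNorm_le {c : AlgFreeProduct A} {C : ℝ} (hC : 0 ≤ C)
    (h : ∀ P : Rep A, ‖P.π c‖ ≤ C) : repNorm c ≤ C :=
  Real.iSup_le h hC

theorem repNorm_star (c : AlgFreeProduct A) : repNorm (star c) = repNorm c := by
  simp only [repNorm, map_star, norm_star]

theorem repNorm_mul_le (c d : AlgFreeProduct A) : repNorm (c * d) ≤ repNorm c * repNorm d := by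
  refine repNorm_le (mul_nonneg (repNorm_nonneg _) (repNorm_nonneg _)) fun P => ?_
  rw [map_mul]
  exact (norm_mul_le _ _).trans
    (mul_le_mul (le_repNorm P c) (le_repNorm P d) (norm_nonneg _) (repNorm_nonneg _))

theorem repNorm_mul_self_le (c : AlgFreeProduct A) :
    repNorm c * repNorm c ≤ repNorm (star c * c) := by
  have h : repNorm c ≤ √(repNorm (star c * c)) := by
    refine repNorm_le (Real.sqrt_nonneg _) fun P => Real.le_sqrt_of_sq_le ?_
    rw [sq, ← CStarRing.norm_star_mul_self, ← map_star, ← map_mul]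
    exact le_repNorm P _
  calc repNorm c * repNorm c ≤ √(repNorm (star c * c)) * √(repNorm (star c * c)) :=
        mul_le_mul h h (repNorm_nonneg _) (Real.sqrt_nonneg _)
    _ = repNorm (star c * c) := Real.mul_self_sqrt (repNorm_nonneg _)

/-- The seminorm on `A ∘ A` bundled as a ring seminorm. -/
noncomputable def ringSeminorm (A : Type u) [CStarAlgebra A] : RingSeminorm (AlgFreeProduct A) where
  toFun := repNorm
  map_zero' := le_antisymm (repNorm_le le_rfl fun P => by simp) (repNorm_nonneg _)
  add_le' c d := by
    refine repNorm_le (add_nonneg (repNorm_nonneg _) (repNorm_nonneg _)) fun P => ?_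
    rw [map_add]
    exact (norm_add_le _ _).trans (add_le_add (le_repNorm P c) (le_repNorm P d))
  neg' c := by simp only [repNorm, map_neg, norm_neg]
  mul_le' := repNorm_mul_le

noncomputable instance : SeminormedRing (AlgFreeProduct A) := (ringSeminorm A).toSeminormedRing

theorem norm_def (c : AlgFreeProduct A) : ‖c‖ = repNorm c := rfl

noncomputable instance : NormedAlgebra ℂ (AlgFreeProduct A) where
  norm_smul_le r c := by
    refine repNorm_le (mul_nonneg (norm_nonneg _) (repNorm_nonneg _)) fun P => ?_
    rw [map_smul, norm_smul]
    exact mul_le_mul_of_nonneg_left (le_repNorm P c) (norm_nonneg _)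

instance : NormedStarGroup (AlgFreeProduct A) where
  norm_star_le c := (repNorm_star c).le

end AlgFreeProduct

/-- The full free product `A * A`: the completion of the algebraic free product `A ∘ A`
for the norm `sup ‖π(c)‖` over all representations. -/
def FullFreeProduct : Type u := Completion (AlgFreeProduct A)

namespace FullFreeProduct

noncomputable instance : NormedRing (FullFreeProduct A) :=
  inferInstanceAs (NormedRing (Completion (AlgFreeProduct A)))

instance : CompleteSpace (FullFreeProduct A) :=
  inferInstanceAs (CompleteSpace (Completion (AlgFreeProduct A)))

noncomputable instance : Algebra ℂ (FullFreeProduct A) :=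
  inferInstanceAs (Algebra ℂ (Completion (AlgFreeProduct A)))

noncomputable instance : NormedAlgebra ℂ (FullFreeProduct A) where
  norm_smul_le r c := norm_smul_le (β := Completion (AlgFreeProduct A)) r c

variable {A}

/-- The canonical map `A ∘ A → A * A`. -/
noncomputable def ofAlg (c : AlgFreeProduct A) : FullFreeProduct A := 
  ((c : Completion (AlgFreeProduct A)))

theorem norm_ofAlg (c : AlgFreeProduct A) : ‖ofAlg c‖ = ‖c‖ := Completion.norm_coe c
theorem ofAlg_mul (c d : AlgFreeProduct A) : ofAlg (c * d) = ofAlg c * ofAlg d :=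
  Completion.coe_mul c d
theorem ofAlg_add (c d : AlgFreeProduct A) : ofAlg (c + d) = ofAlg c + ofAlg d :=
  Completion.coe_add c d
theorem ofAlg_smul (r : ℂ) (c : AlgFreeProduct A) : ofAlg (r • c) = r • ofAlg c :=
  Completion.coe_smul r c
theorem continuous_ofAlg : Continuous (ofAlg : AlgFreeProduct A → FullFreeProduct A) :=
  Completion.continuous_coe _
theorem denseRange_ofAlg : DenseRange (ofAlg : AlgFreeProduct A → FullFreeProduct A) :=
  Completion.denseRange_coe

noncomputable instance : Star (FullFreeProduct A) where
  star := Completion.map (star : AlgFreeProduct A → AlgFreeProduct A)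

theorem uniformContinuous_star' : UniformContinuous (star : AlgFreeProduct A → AlgFreeProduct A) :=
  (AddMonoidHomClass.isometry_of_norm (starAddEquiv : AlgFreeProduct A ≃+ AlgFreeProduct A)
    (fun c => norm_star c)).uniformContinuous

theorem ofAlg_star (c : AlgFreeProduct A) : ofAlg (star c) = star (ofAlg c) :=
  (Completion.map_coe uniformContinuous_star' c).symm

instance : ContinuousStar (FullFreeProduct A) where
  continuous_star := Completion.continuous_map

noncomputable instance : StarRing (FullFreeProduct A) where
  star_involutive c := by
    refine denseRange_ofAlg.induction_on c (isClosed_eq (by fun_prop) (by fun_prop)) fun c => ?_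
    rw [← ofAlg_star, ← ofAlg_star, star_star]
  star_mul c d := by
    refine denseRange_ofAlg.induction_on₂ (isClosed_eq (by fun_prop) (by fun_prop))
      (fun c d => ?_) c d
    rw [← ofAlg_mul, ← ofAlg_star, ← ofAlg_star, ← ofAlg_star, star_mul, ofAlg_mul]
  star_add c d := by
    refine denseRange_ofAlg.induction_on₂ (isClosed_eq (by fun_prop) (by fun_prop))
      (fun c d => ?_) c d
    rw [← ofAlg_add, ← ofAlg_star, ← ofAlg_star, ← ofAlg_star, star_add, ofAlg_add]

instance : StarModule ℂ (FullFreeProduct A) where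
  star_smul r c := by
    refine denseRange_ofAlg.induction_on c
      (isClosed_eq (continuous_star.comp (continuous_const_smul r))
        ((continuous_const_smul (star r)).comp continuous_star)) fun c => ?_
    rw [← ofAlg_smul, ← ofAlg_star, ← ofAlg_star, star_smul, ofAlg_smul]

instance : CStarRing (FullFreeProduct A) where
  norm_mul_self_le c := by
    refine denseRange_ofAlg.induction_on c (isClosed_le (by fun_prop) (by fun_prop)) fun c => ?_
    rw [← ofAlg_star, ← ofAlg_mul, norm_ofAlg, norm_ofAlg]
    exact AlgFreeProduct.repNorm_mul_self_le c

noncomputable instance : CStarAlgebra (FullFreeProduct A) where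

noncomputable instance : PartialOrder (FullFreeProduct A) := CStarAlgebra.spectralOrder _
instance : StarOrderedRing (FullFreeProduct A) := CStarAlgebra.spectralOrderedRing _

/-- The two canonical maps `A → A * A`. -/
noncomputable def ρ (i : Fin 2) : A →⋆ₐ[ℂ] FullFreeProduct A where
  toFun a := ofAlg (AlgFreeProduct.incl i a)
  map_one' := by rw [map_one]; rfl
  map_mul' a b := by rw [map_mul, ofAlg_mul]
  map_zero' := by rw [map_zero]; rfl
  map_add' a b := by rw [map_add, ofAlg_add]
  commutes' r := by rw [AlgHom.commutes]; rfl
  map_star' a := by rw [← AlgFreeProduct.star_incl, ofAlg_star]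

end FullFreeProduct
end FreeProduct

/-! ### Hilbert modules and adjointable operators

A right Hilbert `B`-module is a `CStarModule Bᵐᵒᵖ E`: the inner product is conjugate linear in the
first and linear in the second variable, and `⟪x, y b⟫ = ⟪x, y⟫ b`. -/
section HilbertModules

set_option linter.unusedSectionVars false

variable (B : Type u) [CStarAlgebra B] [PartialOrder B] [StarOrderedRing B]

/-- A (complete) right Hilbert `B`-module. -/
structure HilbertModule : Type (u + 1) where
  carrier : Type u
  [normedAddCommGroup : NormedAddCommGroup carrier]
  [normedSpace : NormedSpace ℂ carrier]
  [completeSpace : CompleteSpace carrier]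
  [module : Module Bᵐᵒᵖ carrier]
  [cstarModule : CStarModule Bᵐᵒᵖ carrier]

namespace HilbertModule

instance : CoeSort (HilbertModule B) (Type u) := ⟨carrier⟩

attribute [instance] normedAddCommGroup normedSpace completeSpace module cstarModule

variable {B} (E : HilbertModule B)

/-- The `B`-valued inner product `⟨x, y⟩`. -/
def inn (x y : E) : B := unop (inner Bᵐᵒᵖ x y)

/-- The right action `x b`. -/
def rsmul (x : E) (b : B) : E := op b • x

variable {E}

theorem inn_rsmul (x y : E) (b : B) : E.inn x (E.rsmul y b) = E.inn x y * b := by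
  simp [inn, rsmul]

theorem star_inn (x y : E) : star (E.inn x y) = E.inn y x := by
  rw [inn, ← unop_star, CStarModule.star_inner]; rfl

theorem inn_add_right (x y z : E) : E.inn x (y + z) = E.inn x y + E.inn x z := by simp [inn]
theorem inn_sub_left (x y z : E) : E.inn (x - y) z = E.inn x z - E.inn y z := by simp [inn]
theorem inn_add_left (x y z : E) : E.inn (x + y) z = E.inn x z + E.inn y z := by simp [inn]
theorem inn_smul_right (r : ℂ) (x y : E) : E.inn x (r • y) = r • E.inn x y := by simp [inn]
theorem inn_smul_left (r : ℂ) (x y : E) : E.inn (r • x) y = star r • E.inn x y := by simp [inn]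

theorem inn_self_eq_zero {x : E} : E.inn x x = 0 ↔ x = 0 := by
  rw [inn, unop_eq_zero_iff, CStarModule.inner_self]

theorem norm_sq_eq (x : E) : ‖x‖ ^ 2 = ‖E.inn x x‖ := CStarModule.norm_sq_eq Bᵐᵒᵖ

theorem norm_inn_le (x y : E) : ‖E.inn x y‖ ≤ ‖x‖ * ‖y‖ :=
  CStarModule.norm_inner_le (A := Bᵐᵒᵖ) E

theorem continuous_inn : Continuous fun p : E × E => E.inn p.1 p.2 :=
  continuous_unop.comp (CStarModule.continuous_inner (A := Bᵐᵒᵖ) (E := E))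

theorem ext_inn {x y : E} (h : ∀ z, E.inn x z = E.inn y z) : x = y := by
  rw [← sub_eq_zero, ← inn_self_eq_zero, inn_sub_left, h, sub_self]

variable (E)

/-- The algebra of bounded operators `T` on `E` that have an adjoint `S`, that is,
`⟨S x, y⟩ = ⟨x, T y⟩` for all `x, y`. -/
def adjointableSubalgebra : Subalgebra ℂ (E →L[ℂ] E) where
  carrier := {T | ∃ S : E →L[ℂ] E, ∀ x y, E.inn (S x) y = E.inn x (T y)}
  mul_mem' := by
    rintro T T' ⟨S, hS⟩ ⟨S', hS'⟩
    exact ⟨S' * S, fun x y => by simp only [mul_apply_eq_comp, hS, hS']⟩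
  add_mem' := by
    rintro T T' ⟨S, hS⟩ ⟨S', hS'⟩
    exact ⟨S + S', fun x y => by
      simp only [_root_.add_apply, inn_add_left, inn_add_right, hS, hS']⟩
  algebraMap_mem' r := ⟨algebraMap ℂ _ (star r), fun x y => by
    simp only [Algebra.algebraMap_eq_smul_one, _root_.smul_apply,
      one_apply_eq_self, inn_smul_left, inn_smul_right, star_star]⟩

/-- The algebra `𝓑ᵃ(E)` of all bounded adjointable operators on the Hilbert module `E`,
with the operator norm. -/
def Adjointable : Type u := E.adjointableSubalgebra

namespace Adjointable

noncomputable instance : NormedRing E.Adjointable :=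
  inferInstanceAs (NormedRing E.adjointableSubalgebra)

noncomputable instance : NormedAlgebra ℂ E.Adjointable :=
  inferInstanceAs (NormedAlgebra ℂ E.adjointableSubalgebra)

variable {E}

/-- The underlying bounded operator. -/
def toCLM (T : E.Adjointable) : E →L[ℂ] E := T.1

noncomputable instance : CoeFun E.Adjointable fun _ => E → E := ⟨fun T => T.toCLM⟩

theorem ext' {S T : E.Adjointable} (h : ∀ x, S x = T x) : S = T :=
  Subtype.ext (ContinuousLinearMap.ext h)

theorem norm_def (T : E.Adjointable) : ‖T‖ = ‖T.toCLM‖ := rfl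
theorem mul_apply (S T : E.Adjointable) (x : E) : (S * T) x = S (T x) := rfl
theorem add_apply (S T : E.Adjointable) (x : E) : (S + T) x = S x + T x := rfl
theorem smul_apply (r : ℂ) (T : E.Adjointable) (x : E) : (r • T) x = r • T x := rfl

/-- The adjoint. -/
noncomputable instance : Star E.Adjointable where
  star T := ⟨T.2.choose, T.toCLM, fun x y => by
    have h : ∀ x y, E.inn (T.2.choose x) y = E.inn x (T.toCLM y) := T.2.choose_spec
    exact (star_inn y (T.toCLM x)).symm.trans
      ((congrArg star (h y x)).symm.trans (star_inn (T.2.choose y) x))⟩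

theorem inn_star_left (T : E.Adjointable) (x y : E) : E.inn (star T x) y = E.inn x (T y) :=
  T.2.choose_spec x y

theorem eq_star {S T : E.Adjointable} (h : ∀ x y, E.inn (S x) y = E.inn x (T y)) : S = star T :=
  ext' fun x => ext_inn fun y => by rw [h, inn_star_left]

theorem inn_star_right (T : E.Adjointable) (x y : E) : E.inn x (star T y) = E.inn (T x) y := by
  rw [← star_inn, inn_star_left, star_inn]

noncomputable instance : StarRing E.Adjointable where
  star_involutive T := (eq_star fun x y => (inn_star_right T x y).symm).symm
  star_mul S T := (eq_star fun x y => by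
    rw [mul_apply, mul_apply, inn_star_left, inn_star_left]).symm
  star_add S T := (eq_star fun x y => by
    rw [add_apply, add_apply, inn_add_left, inn_add_right, inn_star_left, inn_star_left]).symm

instance : StarModule ℂ E.Adjointable where
  star_smul r T := (eq_star fun x y => by
    rw [smul_apply, smul_apply, inn_smul_left, inn_smul_right, inn_star_left, star_star]).symm

instance : CStarRing E.Adjointable where
  norm_mul_self_le T := by
    have h : ‖T‖ ≤ √‖star T * T‖ := by
      refine ContinuousLinearMap.opNorm_le_bound _ (Real.sqrt_nonneg _) fun x => ?_
      refine le_of_sq_le_sq ?_ (mul_nonneg (Real.sqrt_nonneg _) (norm_nonneg _))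
      rw [mul_pow, Real.sq_sqrt (norm_nonneg _)]
      calc ‖T x‖ ^ 2 = ‖E.inn x ((star T * T) x)‖ := by
            rw [norm_sq_eq, mul_apply, inn_star_right]
        _ ≤ ‖x‖ * (‖star T * T‖ * ‖x‖) := (norm_inn_le _ _).trans
            (mul_le_mul_of_nonneg_left ((star T * T).toCLM.le_opNorm x) (norm_nonneg _))
        _ = ‖star T * T‖ * ‖x‖ ^ 2 := by ring
    calc ‖T‖ * ‖T‖ ≤ √‖star T * T‖ * √‖star T * T‖ :=
          mul_le_mul h h (norm_nonneg _) (Real.sqrt_nonneg _)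
      _ = ‖star T * T‖ := Real.mul_self_sqrt (norm_nonneg _)

instance : CompleteSpace E.Adjointable := by
  refine Metric.complete_of_cauchySeq_tendsto fun u hu => ?_
  have hiso : Isometry (toCLM : E.Adjointable → (E →L[ℂ] E)) := isometry_subtype_coe
  have hstar : Isometry (star : E.Adjointable → E.Adjointable) :=
    AddMonoidHomClass.isometry_of_norm (starAddEquiv : E.Adjointable ≃+ E.Adjointable)
      (fun c => norm_star c)
  obtain ⟨T, hT⟩ := cauchySeq_tendsto_of_complete (hiso.uniformContinuous.comp_cauchySeq hu)
  obtain ⟨S, hS⟩ := cauchySeq_tendsto_of_complete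
    ((hiso.comp hstar).uniformContinuous.comp_cauchySeq hu)
  have hmem : T ∈ E.adjointableSubalgebra := by
    refine ⟨S, fun x y => ?_⟩
    have h₁ : Filter.Tendsto (fun n => E.inn (star (u n) x) y) Filter.atTop
        (nhds (E.inn (S x) y)) :=
      (continuous_inn.tendsto (S x, y)).comp
        (((ContinuousLinearMap.apply ℂ E x).continuous.tendsto S |>.comp hS).prodMk_nhds
          tendsto_const_nhds)
    have h₂ : Filter.Tendsto (fun n => E.inn x (u n y)) Filter.atTop
        (nhds (E.inn x (T y))) :=
      (continuous_inn.tendsto (x, T y)).comp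
        (tendsto_const_nhds.prodMk_nhds
          ((ContinuousLinearMap.apply ℂ E y).continuous.tendsto T |>.comp hT))
    simp only [inn_star_left] at h₁
    exact tendsto_nhds_unique h₁ h₂
  exact ⟨⟨T, hmem⟩, hiso.isEmbedding.tendsto_nhds_iff.2 hT⟩

noncomputable instance : CStarAlgebra E.Adjointable where

noncomputable instance : PartialOrder E.Adjointable := CStarAlgebra.spectralOrder _
instance : StarOrderedRing E.Adjointable := CStarAlgebra.spectralOrderedRing _

end Adjointable
end HilbertModule
end HilbertModules

/-! ### The completely bounded norm -/

/-- The completely bounded norm `sup_n ‖ψₙ‖`, where `ψₙ : Mₙ(A) → Mₙ(D)` applies `ψ` to every entry;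
`Mₙ(A)`, `Mₙ(D)` carry their C⋆-norms. -/
noncomputable def cbNorm {A D : Type u} [CStarAlgebra A] [PartialOrder A] [StarOrderedRing A]
    [CStarAlgebra D] [PartialOrder D] [StarOrderedRing D] (ψ : A →ₗ[ℂ] D) : ℝ≥0∞ :=
  ⨆ (n : ℕ) (M : CStarMatrix (Fin n) (Fin n) A) (_ : ‖M‖ ≤ 1), ‖M.map ψ‖ₑ

/-- `‖σ₁ - σ₂‖_cb` for two representations of `A` on a C⋆-algebra. -/
noncomputable def cbDist {A D : Type u} [CStarAlgebra A] [PartialOrder A] [StarOrderedRing A]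
    [CStarAlgebra D] [PartialOrder D] [StarOrderedRing D] (σ₁ σ₂ : A →⋆ₐ[ℂ] D) : ℝ≥0∞ :=
  cbNorm (σ₁.toAlgHom.toLinearMap - σ₂.toAlgHom.toLinearMap)

/-! ### The representation metric -/
section Gamma

variable {A B : Type u} [CStarAlgebra A] [PartialOrder A] [StarOrderedRing A]
  [CStarAlgebra B] [PartialOrder B] [StarOrderedRing B]

/-- A joint representation tuple `(E, σ₁, σ₂, x)` of `φ₁, φ₂`: two unital left actions of `A` on a
Hilbert `B`-module `E` and a unit vector `x` with `φᵢ(a) = ⟨x, σᵢ(a) x⟩`. -/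
structure JointRep (φ₁ φ₂ : A →CP B) : Type (u + 1) where
  E : HilbertModule B
  σ₁ : A →⋆ₐ[ℂ] E.Adjointable
  σ₂ : A →⋆ₐ[ℂ] E.Adjointable
  x : E
  inn_self : E.inn x x = 1
  eq₁ : ∀ a, φ₁ a = E.inn x (σ₁ a x)
  eq₂ : ∀ a, φ₂ a = E.inn x (σ₂ a x)

/-- The representation metric `γ(φ₁, φ₂) = inf ‖σ₁ - σ₂‖_cb` over all joint representation
tuples. -/
noncomputable def gammaDist (φ₁ φ₂ : A →CP B) : ℝ≥0∞ :=
  ⨅ t : JointRep φ₁ φ₂, cbDist t.σ₁ t.σ₂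

/-- `K(φ₁, φ₂)`: the completely positive maps on `A * A` with marginals `φ₁` and `φ₂`. -/
def couplings (φ₁ φ₂ : A →CP B) : Set (FullFreeProduct A →CP B) :=
  {φ | (∀ a, φ (FullFreeProduct.ρ 0 a) = φ₁ a) ∧ ∀ a, φ (FullFreeProduct.ρ 1 a) = φ₂ a}

end Gamma

/-! ### Minimal Stinespring modules -/
section Stinespring

variable {B : Type u} [CStarAlgebra B] [PartialOrder B] [StarOrderedRing B]
  {G : Type u} [NormedAddCommGroup G] [InnerProductSpace ℂ G] [CompleteSpace G]

/-- The interior tensor product `H = E ⊙ G` of a Hilbert `B`-module `E` with a Hilbert space `G` on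
which `B` acts by `ι`, together with the operators `L x : g ↦ x ⊙ g`. It is determined up to a
unique unitary by `(L x)⋆ (L y) = ι ⟨x, y⟩` and the density of the span of all `x ⊙ g`. -/
structure InteriorTensor (ι : B →⋆ₐ[ℂ] (G →L[ℂ] G)) (E : HilbertModule B) : Type (u + 1) where
  H : Type u
  [normedAddCommGroup : NormedAddCommGroup H]
  [innerProductSpace : InnerProductSpace ℂ H]
  [completeSpace : CompleteSpace H]
  L : E →ₗ[ℂ] (G →L[ℂ] H)
  adjoint_comp : ∀ x y, (ContinuousLinearMap.adjoint (L x)).comp (L y) = ι (E.inn x y)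
  dense : (Submodule.span ℂ {h : H | ∃ x g, L x g = h}).topologicalClosure = ⊤

attribute [instance] InteriorTensor.normedAddCommGroup InteriorTensor.innerProductSpace
  InteriorTensor.completeSpace

/-- The strong (operator topology) image of a set of elements of `E`: `E` is viewed inside
`𝓑(G, E ⊙ G)` by `x ↦ L x`, and `𝓑(G, E ⊙ G)` carries the topology of pointwise convergence. -/
def InteriorTensor.strongImage {ι : B →⋆ₐ[ℂ] (G →L[ℂ] G)} {E : HilbertModule B}
    (T : InteriorTensor ι E) (S : Set E) : Set (G →Lₚₜ[ℂ] T.H) :=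
  (fun x => ContinuousLinearMap.toPointwiseConvergenceCLM ℂ (RingHom.id ℂ) G T.H (T.L x)) '' S

/-- `E` is a von Neumann `B`-module: it is strongly closed in `𝓑(G, E ⊙ G)`. -/
def IsVonNeumannModule (ι : B →⋆ₐ[ℂ] (G →L[ℂ] G)) (E : HilbertModule B) : Prop :=
  ∃ T : InteriorTensor ι E, IsClosed (T.strongImage Set.univ)

variable {C : Type u} [CStarAlgebra C] [PartialOrder C] [StarOrderedRing C]

/-- A Stinespring (GNS) module `(E, σ, x)` of a completely positive map `φ : C → B`: a Hilbert
`B`-module `E` with a unital left action `σ` of `C` and `x ∈ E` with `φ(c) = ⟨x, σ(c) x⟩`. -/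
structure StinespringModule (φ : C →CP B) : Type (u + 1) where
  E : HilbertModule B
  σ : C →⋆ₐ[ℂ] E.Adjointable
  x : E
  eq : ∀ c, φ c = E.inn x (σ c x)

namespace StinespringModule

variable {φ : C →CP B} (D : StinespringModule φ)

/-- The span of `C x B`. -/
def spanCxB : Submodule ℂ D.E :=
  Submodule.span ℂ {y | ∃ (c : C) (b : B), y = D.E.rsmul (D.σ c D.x) b}

/-- Minimality as a Hilbert module: the span of `C x B` is norm dense in `E`. -/
def IsMinimal : Prop := D.spanCxB.topologicalClosure = ⊤

/-- Minimality as a von Neumann module: `E` is a von Neumann `B`-module and the span of `C x B` is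
strongly dense in `E`. -/
def IsStronglyMinimal (ι : B →⋆ₐ[ℂ] (G →L[ℂ] G)) : Prop :=
  IsVonNeumannModule ι D.E ∧
    ∃ T : InteriorTensor ι D.E, T.strongImage Set.univ ⊆ closure (T.strongImage D.spanCxB)

end StinespringModule

/-- `‖σ₁ - σ₂‖_cb` for the two left actions `σᵢ = σ ∘ ρᵢ` of `A` on a Stinespring module of a
completely positive map on `A * A`. -/
noncomputable def StinespringModule.cbDist {A : Type u} [CStarAlgebra A] [PartialOrder A]
    [StarOrderedRing A] {φ : FullFreeProduct A →CP B} (D : StinespringModule φ) : ℝ≥0∞ :=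
  _root_.cbDist (D.σ.comp (FullFreeProduct.ρ 0)) (D.σ.comp (FullFreeProduct.ρ 1))

end Stinespring

open scoped InnerProductSpace ComplexOrder

/-! The infimum is attained by compactness of the set of couplings together with lower
semicontinuity of the cb distance.

By the universal property of the free product, a joint representation tuple is the same as a
coupling `φ` with one of its Stinespring modules (`JointRep.exists_coupling`,
`StinespringModule.gammaDist_le_cbDist`), and tuples exist (`JointRep.nonempty`). The couplings of a
minimizing sequence of tuples are uniformly bounded, so along an ultrafilter they converge in the
point-weak operator topology. The limit takes values in `B`, because a von Neumann algebra is weakly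
closed, and complete positivity and the marginals pass to the limit
(`CompletelyPositiveMap.exists_tendsto_inner`, `couplings.of_tendsto`).

For semicontinuity, the bound `‖σ₁ - σ₂‖_cb ≤ r` is tested on vectors `∑ σ(c) x ⊙ g` of `E ⊙ G`.
Their norms are finite sums of coefficients `⟪g, φ(c⋆ d) h⟫`, so the test, `CbDistLE`, concerns `φ`
alone and survives weak limits. It is necessary in every module of `φ`, and sufficient when these
vectors are dense in `E ⊙ G`, which either kind of minimality ensures. Hence the limit coupling
satisfies the test for all `r > γ`, and its minimal modules have cb distance at most `γ`; the
reverse inequality holds because they are joint representations themselves.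

The modules needed along the way are spaces of operators `G → H` whose products `x⋆ y` lie in `B`,
obtained by dilating positive operator valued kernels. The minimal modules are the norm and strong
closures of the span of the operators `(L c) (ι b)`. -/

theorem StarAlgHom.nonneg_iff_of_injective {A D : Type*} [CStarAlgebra A] [PartialOrder A]
    [StarOrderedRing A] [CStarAlgebra D] [PartialOrder D] [StarOrderedRing D]
    (π : A →⋆ₐ[ℂ] D) (hπ : Function.Injective π) {a : A} : 0 ≤ π a ↔ 0 ≤ a := by
  constructor
  · intro h
    have ha : IsSelfAdjoint a := by
      have := IsSelfAdjoint.of_nonneg h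
      rw [isSelfAdjoint_iff, ← map_star] at this
      exact hπ this
    have hs := ha.map_spectrum_real π hπ
    rw [StarOrderedRing.nonneg_iff_spectrum_nonneg (R := ℝ) (A := A) a]
    rw [StarOrderedRing.nonneg_iff_spectrum_nonneg (R := ℝ) (π a), hs] at h
    exact h
  · intro h
    obtain ⟨b, rfl⟩ := (CStarAlgebra.nonneg_iff_eq_star_mul_self).1 h
    rw [map_mul, map_star]
    exact star_mul_self_nonneg _

/-! ### Norm and order of `Mₙ(D)` through a faithful representation of `D`. -/

section MatrixRepresentation

set_option linter.unusedSectionVars false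

variable {D : Type*} [CStarAlgebra D] {n : Type*} [Fintype n] [DecidableEq n]
  {H : Type*} [NormedAddCommGroup H] [InnerProductSpace ℂ H] [CompleteSpace H]

/-- The operator on `Hⁿ` defined by a matrix of operators on `H`. -/
noncomputable def matrixOperator (T : n → n → H →L[ℂ] H) :
    PiLp 2 (fun _ : n => H) →L[ℂ] PiLp 2 (fun _ : n => H) :=
  ((PiLp.continuousLinearEquiv 2 ℂ (fun _ : n => H)).symm : (n → H) →L[ℂ] _) ∘L
    (ContinuousLinearMap.pi fun i => ∑ j, T i j ∘L ContinuousLinearMap.proj j) ∘L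
    ((PiLp.continuousLinearEquiv 2 ℂ (fun _ : n => H)) : _ →L[ℂ] (n → H))

theorem matrixOperator_apply (T : n → n → H →L[ℂ] H) (h : PiLp 2 (fun _ : n => H)) (i : n) :
    matrixOperator T h i = ∑ j, T i j (h j) := by
  simp [matrixOperator]

variable [PartialOrder D] [StarOrderedRing D]

/-- The amplification of a representation of `D` on `H` to a representation of `Mₙ(D)` on `Hⁿ`. -/
noncomputable def matrixRep (ρ : D →⋆ₐ[ℂ] (H →L[ℂ] H)) :
    CStarMatrix n n D →⋆ₐ[ℂ] (PiLp 2 (fun _ : n => H) →L[ℂ] PiLp 2 (fun _ : n => H)) where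
  toFun M := matrixOperator fun i j => ρ (M i j)
  map_one' := by
    ext h i
    simp [matrixOperator_apply, CStarMatrix.one_apply, apply_ite, ite_apply]
  map_mul' M N := by
    ext h i
    simp only [matrixOperator_apply, CStarMatrix.mul_apply, map_sum, map_mul,
      sum_apply, mul_apply_eq_comp]
    exact Finset.sum_comm
  map_zero' := by
    ext h i
    simp [matrixOperator_apply]
  map_add' M N := by
    ext h i
    simp [matrixOperator_apply, Finset.sum_add_distrib]
  commutes' r := by
    ext h i
    simp [matrixOperator_apply, CStarMatrix.algebraMap_apply, apply_ite, ite_apply]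
    rw [AlgHomClass.commutes, Algebra.algebraMap_eq_smul_one]
    rfl
  map_star' M := by
    refine (ContinuousLinearMap.eq_adjoint_iff _ _).2 fun x y => ?_
    simp only [PiLp.inner_apply, matrixOperator_apply, sum_inner, inner_sum]
    rw [Finset.sum_comm]
    refine Finset.sum_congr rfl fun i _ => Finset.sum_congr rfl fun j _ => ?_
    rw [CStarMatrix.star_apply, map_star, ContinuousLinearMap.star_eq_adjoint,
      ContinuousLinearMap.adjoint_inner_left]

theorem matrixRep_apply (ρ : D →⋆ₐ[ℂ] (H →L[ℂ] H)) (M : CStarMatrix n n D)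
    (h : PiLp 2 (fun _ : n => H)) (i : n) : matrixRep ρ M h i = ∑ j, ρ (M i j) (h j) :=
  matrixOperator_apply _ h i

theorem matrixRep_injective {ρ : D →⋆ₐ[ℂ] (H →L[ℂ] H)} (hρ : Function.Injective ρ) :
    Function.Injective (matrixRep (n := n) ρ) := by
  intro M N h
  ext i j
  refine hρ (ContinuousLinearMap.ext fun x => ?_)
  have := congrArg (fun T => T (PiLp.single 2 j x) i) h
  simpa [matrixRep_apply, PiLp.single_apply, apply_ite, Pi.single_apply] using this

/-- An injective `*`-homomorphism is isometric, so the C⋆-norm of `Mₙ(D)` is the operator norm on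
`Hⁿ`. In squared form both sides are sums of squared norms, hence expressible by inner products. -/
theorem CStarMatrix.norm_le_iff {ρ : D →⋆ₐ[ℂ] (H →L[ℂ] H)} (hρ : Function.Injective ρ)
    (M : CStarMatrix n n D) {r : ℝ} (hr : 0 ≤ r) :
    ‖M‖ ≤ r ↔ ∀ h : n → H, ∑ i, ‖∑ j, ρ (M i j) (h j)‖ ^ 2 ≤ r ^ 2 * ∑ j, ‖h j‖ ^ 2 := by
  rw [← NonUnitalStarAlgHom.norm_map (matrixRep ρ) (matrixRep_injective hρ) M,
    ContinuousLinearMap.opNorm_le_iff hr]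
  have key : ∀ h : PiLp 2 (fun _ : n => H), ‖matrixRep ρ M h‖ ≤ r * ‖h‖ ↔
      ∑ i, ‖∑ j, ρ (M i j) (h j)‖ ^ 2 ≤ r ^ 2 * ∑ j, ‖h j‖ ^ 2 := fun h => by
    rw [← sq_le_sq₀ (norm_nonneg _) (by positivity), mul_pow, PiLp.norm_sq_eq_of_L2,
      PiLp.norm_sq_eq_of_L2]
    simp only [matrixRep_apply]
  exact ⟨fun H' h => (key (WithLp.toLp 2 h)).1 (H' _), fun H' h => (key h).2 (H' h)⟩

/-- Injective `*`-homomorphisms reflect positivity, and on a complex Hilbert space positivity of an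
operator is nonnegativity of its quadratic form. -/
theorem CStarMatrix.nonneg_iff {ρ : D →⋆ₐ[ℂ] (H →L[ℂ] H)} (hρ : Function.Injective ρ)
    (M : CStarMatrix n n D) :
    0 ≤ M ↔ ∀ h : n → H, 0 ≤ ∑ i, ∑ j, ⟪h i, ρ (M i j) (h j)⟫_ℂ := by
  rw [← StarAlgHom.nonneg_iff_of_injective (matrixRep ρ) (matrixRep_injective hρ),
    ContinuousLinearMap.nonneg_iff_isPositive, ContinuousLinearMap.isPositive_iff_complex]
  have key : ∀ h : PiLp 2 (fun _ : n => H),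
      ((RCLike.re ⟪matrixRep ρ M h, h⟫_ℂ : ℂ) = ⟪matrixRep ρ M h, h⟫_ℂ ∧
        0 ≤ RCLike.re ⟪matrixRep ρ M h, h⟫_ℂ) ↔
      0 ≤ ∑ i, ∑ j, ⟪h i, ρ (M i j) (h j)⟫_ℂ := fun h => by
    have e : ∑ i, ∑ j, ⟪h i, ρ (M i j) (h j)⟫_ℂ = ⟪h, matrixRep ρ M h⟫_ℂ := by
      simp only [PiLp.inner_apply, matrixRep_apply, inner_sum]
    rw [e, Complex.nonneg_iff, ← inner_conj_symm (matrixRep ρ M h) h, Complex.ext_iff]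
    simp only [RCLike.re_to_complex, Complex.conj_re, Complex.conj_im, Complex.ofReal_re,
      Complex.ofReal_im, true_and, zero_eq_neg, and_comm, eq_comm]
  exact ⟨fun H' h => (key (WithLp.toLp 2 h)).1 (H' _), fun H' h => (key h).2 (H' h)⟩

end MatrixRepresentation

/-! ### Positive operator valued kernels and their dilations. -/

section KernelDilation

variable {X G : Type u} [NormedAddCommGroup G] [InnerProductSpace ℂ G]

/-- The quadratic form `∑ ⟪f x, K x y (f y)⟫` of an operator valued kernel. -/
noncomputable def kernelForm (K : X → X → G →L[ℂ] G) (f : X →₀ G) : ℂ :=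
  f.sum fun x v => f.sum fun y w => ⟪v, K x y w⟫_ℂ

variable [CompleteSpace G]

/-- A Hilbert space `H` and operators `L x : G → H` with `(L x)⋆ (L y) = K x y` and such that
the vectors `L x g` are total in `H`. -/
structure KernelDilation (K : X → X → G →L[ℂ] G) : Type (u + 1) where
  H : Type u
  [normedAddCommGroup : NormedAddCommGroup H]
  [innerProductSpace : InnerProductSpace ℂ H]
  [completeSpace : CompleteSpace H]
  L : X → G →L[ℂ] H
  adjoint_comp : ∀ x y, (ContinuousLinearMap.adjoint (L x)).comp (L y) = K x y
  dense : (Submodule.span ℂ {h : H | ∃ x g, L x g = h}).topologicalClosure = ⊤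

attribute [instance] KernelDilation.normedAddCommGroup KernelDilation.innerProductSpace
  KernelDilation.completeSpace

/-- An operator valued kernel is positive if it is hermitian and its quadratic form is
nonnegative. -/
structure IsPositiveKernel (K : X → X → G →L[ℂ] G) : Prop where
  adjoint_eq : ∀ x y, ContinuousLinearMap.adjoint (K x y) = K y x
  form_nonneg : ∀ f, 0 ≤ (kernelForm K f).re

/-- The reproducing kernel Hilbert space of `K` is a dilation, `L x` being the kernel function at
`x`. -/
theorem IsPositiveKernel.nonempty_dilation {K : X → X → G →L[ℂ] G} (hK : IsPositiveKernel K) :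
    Nonempty (KernelDilation K) := by
  have hp : (Matrix.of K).PosSemidef := by
    have h := (RKHS.posSemidef_tfae (K := Matrix.of K)).out 0 2
    refine h.2 ⟨?_, fun f => ?_⟩
    · exact Matrix.IsHermitian.ext fun x y => hK.adjoint_eq y x
    · refine (hK.form_nonneg f).trans_eq (congrArg Complex.re ?_)
      refine Finsupp.sum_congr fun x _ => Finsupp.sum_congr fun y _ => ?_
      rw [Matrix.of_apply, ← hK.adjoint_eq x y, ContinuousLinearMap.adjoint_inner_left]
  have : Fact (Matrix.of K).PosSemidef := ⟨hp⟩
  refine ⟨{ H := RKHS.OfKernel (Matrix.of K), L := RKHS.kerFun _, adjoint_comp := fun x y => ?_,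
            dense := ?_ }⟩
  · rw [← RKHS.kernel_apply, RKHS.OfKernel.kernel_ofKernel, Matrix.of_apply]
  · exact RKHS.kerFun_dense _

/-- The quadratic form at `f` is `‖∑ L x (f x)‖²`. -/
theorem isPositiveKernel_of_adjoint_comp {H : Type*} [NormedAddCommGroup H] [InnerProductSpace ℂ H]
    [CompleteSpace H] (L : X → G →L[ℂ] H) :
    IsPositiveKernel fun x y => (ContinuousLinearMap.adjoint (L x)).comp (L y) where
  adjoint_eq x y := by simp [ContinuousLinearMap.adjoint_comp]
  form_nonneg f := by
    have : kernelForm (fun x y => (ContinuousLinearMap.adjoint (L x)).comp (L y)) f =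
        ⟪f.sum fun x v => L x v, f.sum fun x v => L x v⟫_ℂ := by
      simp only [kernelForm, Finsupp.sum_inner, Finsupp.inner_sum, ContinuousLinearMap.comp_apply,
        ContinuousLinearMap.adjoint_inner_right]
      exact Finsupp.sum_comm ..
    rw [this]
    exact inner_self_nonneg (𝕜 := ℂ)

theorem IsPositiveKernel.add {K K' : X → X → G →L[ℂ] G} (hK : IsPositiveKernel K)
    (hK' : IsPositiveKernel K') : IsPositiveKernel fun x y => K x y + K' x y where
  adjoint_eq x y := by rw [map_add, hK.adjoint_eq, hK'.adjoint_eq]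
  form_nonneg f := by
    have : kernelForm (fun x y => K x y + K' x y) f = kernelForm K f + kernelForm K' f := by
      simp only [kernelForm, _root_.add_apply, inner_add_right, Finsupp.sum_add]
    rw [this, Complex.add_re]
    exact add_nonneg (hK.form_nonneg f) (hK'.form_nonneg f)

/-- An action of a C⋆-algebra on the index set of a kernel by adjointable maps. -/
structure IsKernelAction {C : Type*} [CStarAlgebra C] (K : X → X → G →L[ℂ] G) (s : C → X → X) :
    Prop where
  one : ∀ x, s 1 x = x
  mul : ∀ c d x, s (c * d) x = s c (s d x)
  adjoint : ∀ c x y, K (s c x) y = K x (s (star c) y)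
  -- The index set carries no linear structure, so linearity in the algebra is required only after
  -- pairing with `K`.
  add : ∀ c d x y, K x (s (c + d) y) = K x (s c y) + K x (s d y)
  smul : ∀ (r : ℂ) c x y, K x (s (r • c) y) = r • K x (s c y)

namespace KernelDilation

variable {K : X → X → G →L[ℂ] G} (D : KernelDilation K)

/-- The canonical map from finitely supported `G`-valued functions to the dilation space. -/
noncomputable def total : (X →₀ G) →ₗ[ℂ] D.H :=
  Finsupp.lsum ℂ fun x => (D.L x : G →ₗ[ℂ] D.H)

theorem total_apply (f : X →₀ G) : D.total f = f.sum fun x g => D.L x g := rfl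

theorem total_single (x : X) (g : G) : D.total (Finsupp.single x g) = D.L x g := by
  simp [total_apply]

theorem inner_L_L (x y : X) (g h : G) : ⟪D.L x g, D.L y h⟫_ℂ = ⟪g, K x y h⟫_ℂ := by
  rw [← D.adjoint_comp, ContinuousLinearMap.comp_apply, ContinuousLinearMap.adjoint_inner_right]

theorem inner_total (f g : X →₀ G) :
    ⟪D.total f, D.total g⟫_ℂ = f.sum fun x v => g.sum fun y w => ⟪v, K x y w⟫_ℂ := by
  simp only [total_apply, Finsupp.sum, sum_inner, inner_sum, inner_L_L]
  exact Finset.sum_comm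

theorem denseRange_total : DenseRange D.total := by
  have h : Submodule.span ℂ {h : D.H | ∃ x g, D.L x g = h} ≤ LinearMap.range D.total := by
    rw [Submodule.span_le]
    rintro _ ⟨x, g, rfl⟩
    exact ⟨_, D.total_single x g⟩
  have hd := (Submodule.dense_iff_topologicalClosure_eq_top).2 D.dense
  exact hd.mono h

theorem clm_ext {F : Type*} [NormedAddCommGroup F] [NormedSpace ℂ F] {S T : D.H →L[ℂ] F}
    (h : ∀ x g, S (D.L x g) = T (D.L x g)) : S = T := by
  have : (S : D.H →ₗ[ℂ] F) ∘ₗ D.total = (T : D.H →ₗ[ℂ] F) ∘ₗ D.total :=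
    Finsupp.lhom_ext fun x g => by simpa [total_single] using h x g
  exact DFunLike.coe_injective (D.denseRange_total.equalizer S.continuous T.continuous
    (funext fun f => LinearMap.congr_fun this f))

theorem ext_inner_L {u v : D.H} (h : ∀ x g, ⟪D.L x g, u⟫_ℂ = ⟪D.L x g, v⟫_ℂ) : u = v := by
  refine ext_inner_right ℂ fun w => ?_
  refine DFunLike.congr_fun (f := innerSL ℂ u) (g := innerSL ℂ v) (D.clm_ext fun x g => ?_) w
  rw [innerSL_apply_apply, innerSL_apply_apply, ← inner_conj_symm, h, inner_conj_symm]

variable {C : Type*} [CStarAlgebra C] {s : C → X → X} (hs : IsKernelAction K s)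

set_option linter.unusedSectionVars false

/-- The action on finitely supported functions. -/
noncomputable def totalAct (s : C → X → X) (c : C) : (X →₀ G) →ₗ[ℂ] D.H :=
  D.total ∘ₗ Finsupp.lmapDomain G ℂ (s c)

theorem totalAct_apply (c : C) (f : X →₀ G) :
    D.totalAct s c f = f.sum fun x g => D.L (s c x) g := by
  simp [totalAct, total_apply, Finsupp.sum_mapDomain_index]

include hs

/-- Choose `d` with `c⋆ c + d⋆ d = ‖c‖² 1`. Then the squared norms of `c f` and `d f` add up to
`‖c‖² ‖f‖²`, and the second is dropped. The bound gives at once that the action respects the null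
vectors of the form and that it extends boundedly. -/
theorem norm_totalAct_le (c : C) (f : X →₀ G) : ‖D.totalAct s c f‖ ≤ ‖c‖ * ‖D.total f‖ := by
  let _ : PartialOrder C := CStarAlgebra.spectralOrder C
  have : StarOrderedRing C := CStarAlgebra.spectralOrderedRing C
  obtain ⟨d, hd⟩ := CStarAlgebra.nonneg_iff_eq_star_mul_self.1
    (sub_nonneg.2 (CStarAlgebra.star_mul_le_algebraMap_norm_sq (a := c)))
  have hsq : ∀ u : D.H, (‖u‖ : ℂ) ^ 2 = ⟪u, u⟫_ℂ := fun u => (inner_self_eq_norm_sq_to_K u).symm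
  have hform : ∀ e : C, (‖D.totalAct s e f‖ : ℂ) ^ 2 =
      f.sum fun x v => f.sum fun y w => ⟪v, K x (s (star e * e) y) w⟫_ℂ := fun e => by
    rw [hsq, totalAct_apply]
    simp only [Finsupp.sum, sum_inner, inner_sum, inner_L_L, hs.adjoint, ← hs.mul]
    exact Finset.sum_comm
  have hsum : star c * c + star d * d = ((‖c‖ ^ 2 : ℝ) : ℂ) • (1 : C) := by
    rw [← hd]
    rw [add_sub_cancel, Algebra.algebraMap_eq_smul_one]
    exact (Complex.coe_smul _ _).symm
  have h : (‖D.totalAct s c f‖ : ℂ) ^ 2 + (‖D.totalAct s d f‖ : ℂ) ^ 2 =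
      (‖c‖ : ℂ) ^ 2 * (‖D.total f‖ : ℂ) ^ 2 := by
    rw [hform, hform, hsq (D.total f), inner_total]
    simp only [Finsupp.sum, ← Finset.sum_add_distrib, ← inner_add_right, ← _root_.add_apply,
      ← hs.add, hsum, hs.smul, hs.one, Finset.mul_sum, _root_.smul_apply, inner_smul_right]
    simp
  have h' : ‖D.totalAct s c f‖ ^ 2 + ‖D.totalAct s d f‖ ^ 2 = ‖c‖ ^ 2 * ‖D.total f‖ ^ 2 := by
    exact_mod_cast h
  refine le_of_sq_le_sq ?_ (by positivity)
  rw [mul_pow]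
  nlinarith [sq_nonneg ‖D.totalAct s d f‖]

/-- The representation on the dilation space induced by an action on the index set. -/
noncomputable def act : C →⋆ₐ[ℂ] (D.H →L[ℂ] D.H) :=
  have key : ∀ c x g, (D.totalAct s c).extendOfNorm D.total (D.L x g) = D.L (s c x) g :=
    fun c x g => by
      rw [← total_single, LinearMap.extendOfNorm_eq D.denseRange_total
        ⟨_, D.norm_totalAct_le hs c⟩, totalAct_apply]
      simp
  have hadd : ∀ c d x g, D.L (s (c + d) x) g = D.L (s c x) g + D.L (s d x) g :=
    fun c d x g => D.ext_inner_L fun y h => by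
      simp only [inner_add_right, inner_L_L, hs.add, _root_.add_apply]
  have hsmul : ∀ (r : ℂ) c x g, D.L (s (r • c) x) g = r • D.L (s c x) g :=
    fun r c x g => D.ext_inner_L fun y h => by
      simp only [inner_smul_right, inner_L_L, hs.smul, _root_.smul_apply]
  { toFun := fun c => (D.totalAct s c).extendOfNorm D.total
    map_one' := D.clm_ext fun x g => by rw [key, hs.one]; rfl
    map_mul' := fun c d => D.clm_ext fun x g => by
      rw [mul_apply_eq_comp, key, key, key, hs.mul]
    map_zero' := D.clm_ext fun x g => by
      rw [key, ← zero_smul ℂ (0 : C), hsmul, zero_smul]; rfl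
    map_add' := fun c d => D.clm_ext fun x g => by
      rw [_root_.add_apply, key, key, key, hadd]
    commutes' := fun r => D.clm_ext fun x g => by
      rw [key, Algebra.algebraMap_eq_smul_one, hsmul, hs.one]; rfl
    map_star' := fun c => D.clm_ext fun x g => D.ext_inner_L fun y h => by
      rw [ContinuousLinearMap.star_eq_adjoint, ContinuousLinearMap.adjoint_inner_right, key, key,
        inner_L_L, inner_L_L, hs.adjoint] }

theorem act_L (c : C) (x : X) (g : G) : D.act hs c (D.L x g) = D.L (s c x) g := by
  change (D.totalAct s c).extendOfNorm D.total (D.L x g) = D.L (s c x) g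
  rw [← total_single, LinearMap.extendOfNorm_eq D.denseRange_total
        ⟨_, D.norm_totalAct_le hs c⟩, totalAct_apply]
  simp

end KernelDilation

end KernelDilation

/-! ### Positivity of matrices over a C⋆-algebra and of Gram matrices. -/

section GramMatrix

set_option linter.unusedSectionVars false

theorem CStarAlgebra.exists_sub_of_isSelfAdjoint {A : Type*} [CStarAlgebra A] [PartialOrder A]
    [StarOrderedRing A] {a : A} (ha : IsSelfAdjoint a) :
    ∃ p z : A, 0 ≤ p ∧ p * (z * star z) = 0 ∧ a = p - z * star z := by
  obtain ⟨z, hz⟩ := CStarAlgebra.nonneg_iff_eq_mul_star_self.1 (CFC.negPart_nonneg a)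
  exact ⟨a⁺, z, CFC.posPart_nonneg a, hz ▸ CFC.posPart_mul_negPart a,
    hz ▸ (CFC.posPart_sub_negPart a ha).symm⟩

/-- Write `X = P - N` with `P N = 0`, so that `N⋆ X N = -N³`. The columns of `N` as test vectors
make the diagonal of `-N³` nonnegative. But with `N = Z Z⋆` and `Y = Z⋆ N` one has `N³ = Y⋆ Y`,
whose diagonal entries are the sums `∑ₖ Yₖⱼ⋆ Yₖⱼ`. All entries of `Y` therefore vanish, and `N³ = 0`
forces `N = 0`. -/
theorem CStarMatrix.nonneg_of_forall {B : Type*} [CStarAlgebra B] [PartialOrder B]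
    [StarOrderedRing B] {n : Type*} [Fintype n] [DecidableEq n] {X : CStarMatrix n n B}
    (hX : IsSelfAdjoint X) (h : ∀ b : n → B, 0 ≤ ∑ i, ∑ j, star (b i) * X i j * b j) : 0 ≤ X := by
  obtain ⟨P, Z, hP0, hPN, rfl⟩ := CStarAlgebra.exists_sub_of_isSelfAdjoint hX
  obtain ⟨N, hZ⟩ : ∃ N, N = Z * star Z := ⟨_, rfl⟩
  rw [← hZ] at hPN h ⊢
  suffices hN : N = 0 by rwa [hN, sub_zero]
  have hNs : star N = N := by rw [hZ, star_mul, star_star]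
  have hNXN : star N * (P - N) * N = -(N * N * N) := by
    rw [hNs, mul_assoc, sub_mul, hPN]
    simp [mul_assoc]
  have hY : N * N * N = star (star Z * N) * (star Z * N) := by
    conv_lhs => rw [mul_assoc]; enter [2, 1]; rw [hZ]
    rw [star_mul, star_star, hNs]
    simp only [mul_assoc]
  have hY0 : star Z * N = 0 := by
    ext k j
    have h1 : 0 ≤ (star N * (P - N) * N) j j := by
      convert! h fun i => N i j using 1
      simp only [CStarMatrix.mul_apply, CStarMatrix.star_apply, Finset.sum_mul]
      exact Finset.sum_comm
    rw [hNXN, hY, CStarMatrix.neg_apply, CStarMatrix.mul_apply, Left.nonneg_neg_iff] at h1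
    have h2 := (Finset.sum_eq_zero_iff_of_nonneg fun i _ => ?_).1
      (le_antisymm h1 (Finset.sum_nonneg fun i _ => ?_)) k (Finset.mem_univ k)
    · rwa [CStarMatrix.star_apply, CStarRing.star_mul_self_eq_zero_iff] at h2
    all_goals
      rw [CStarMatrix.star_apply]
      exact star_mul_self_nonneg _
  rw [hY0, mul_zero] at hY
  have h2 : N * N = 0 := by
    rw [← CStarRing.star_mul_self_eq_zero_iff, star_mul, hNs, ← mul_assoc, hY, zero_mul]
  rwa [← CStarRing.star_mul_self_eq_zero_iff, hNs]

variable {X B G : Type u} [CStarAlgebra B] [PartialOrder B] [StarOrderedRing B]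
  [NormedAddCommGroup G] [InnerProductSpace ℂ G] [CompleteSpace G]
  {ι : B →⋆ₐ[ℂ] (G →L[ℂ] G)}

theorem isPositiveKernel_of_matrix_nonneg (hι : Function.Injective ι) {k : X → X → B}
    (hk : ∀ x y, star (k x y) = k y x)
    (h : ∀ s : Finset X, 0 ≤ (CStarMatrix.ofMatrix fun i j : s => k i j : CStarMatrix s s B)) :
    IsPositiveKernel fun x y => ι (k x y) where
  adjoint_eq x y := by rw [← ContinuousLinearMap.star_eq_adjoint, ← map_star, hk]
  form_nonneg f := by
    classical
    have := (CStarMatrix.nonneg_iff hι _).1 (h f.support) fun i => f i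
    rw [Complex.nonneg_iff] at this
    convert! this.1 using 2
    simp only [kernelForm, Finsupp.sum]
    rw [← Finset.sum_coe_sort]
    refine Finset.sum_congr rfl fun i _ => ?_
    rw [← Finset.sum_coe_sort]
    rfl

theorem HilbertModule.inn_self_nonneg {E : HilbertModule B} (x : E) : 0 ≤ E.inn x x :=
  CStarModule.inner_self_nonneg (A := Bᵐᵒᵖ) (x := x)

/-- The form of the Gram matrix at `b` is the inner square of `∑ xᵢ bᵢ`. -/
theorem HilbertModule.gram_nonneg {E : HilbertModule B} {n : Type*} [Fintype n] [DecidableEq n]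
    (x : n → E) :
    0 ≤ (CStarMatrix.ofMatrix fun i j => E.inn (x i) (x j) : CStarMatrix n n B) := by
  refine CStarMatrix.nonneg_of_forall ?_ fun b => ?_
  · ext i j
    exact HilbertModule.star_inn _ _
  · convert! HilbertModule.inn_self_nonneg (∑ i, E.rsmul (x i) (b i)) using 1
    simp only [HilbertModule.inn, HilbertModule.rsmul, CStarModule.inner_sum_left,
      CStarModule.inner_sum_right, Finset.unop_sum, CStarModule.inner_op_smul_left,
      CStarModule.inner_op_smul_right, unop_mul, unop_op, ← op_star]
    exact Finset.sum_comm.trans (Finset.sum_congr rfl fun i _ => (Finset.sum_mul ..).symm)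

theorem HilbertModule.isPositiveKernel (hι : Function.Injective ι) (E : HilbertModule B) :
    IsPositiveKernel fun x y : E => ι (E.inn x y) :=
  isPositiveKernel_of_matrix_nonneg hι HilbertModule.star_inn fun s => by
    classical
    exact HilbertModule.gram_nonneg _

end GramMatrix

/-! ### Existence of `E ⊙ G` and the faithful representation of `𝓑ᵃ(E)` on it. -/

section InteriorTensor

set_option linter.unusedSectionVars false

variable {B G : Type u} [CStarAlgebra B] [PartialOrder B] [StarOrderedRing B]
  [NormedAddCommGroup G] [InnerProductSpace ℂ G] [CompleteSpace G]
  {ι : B →⋆ₐ[ℂ] (G →L[ℂ] G)}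

/-- The dilation of the kernel `ι ⟨x, y⟩` is the tensor product. Linearity of `L` is not part of a
dilation; it follows by pairing with the total vectors `L z h`, since the kernel is linear in its
second variable. -/
theorem InteriorTensor.nonempty (hι : Function.Injective ι) (E : HilbertModule B) :
    Nonempty (InteriorTensor ι E) := by
  obtain ⟨D⟩ := (E.isPositiveKernel hι).nonempty_dilation
  exact ⟨{
    H := D.H
    L :=
      { toFun := D.L
        map_add' := fun x y => ContinuousLinearMap.ext fun g => D.ext_inner_L fun z h => by
          simp only [_root_.add_apply, inner_add_right, D.inner_L_L, HilbertModule.inn_add_right,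
            map_add]
        map_smul' := fun r x => ContinuousLinearMap.ext fun g => D.ext_inner_L fun z h => by
          simp only [_root_.smul_apply, inner_smul_right, D.inner_L_L,
            HilbertModule.inn_smul_right, map_smul, RingHom.id_apply] }
    adjoint_comp := D.adjoint_comp
    dense := D.dense }⟩

namespace InteriorTensor

variable {E : HilbertModule B} (T : InteriorTensor ι E)

/-- The interior tensor product as a dilation of the kernel `ι ⟨x, y⟩`. -/
def toKernelDilation : KernelDilation fun x y : E => ι (E.inn x y) where
  H := T.H
  L := T.L
  adjoint_comp := T.adjoint_comp
  dense := T.dense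

theorem isKernelAction_adjointable (ι : B →⋆ₐ[ℂ] (G →L[ℂ] G)) (E : HilbertModule B) :
    IsKernelAction (fun x y : E => ι (E.inn x y)) fun (S : E.Adjointable) x => S x where
  one _ := rfl
  mul _ _ _ := rfl
  adjoint S x y := by rw [HilbertModule.Adjointable.inn_star_right]
  add S S' x y := by
    rw [HilbertModule.Adjointable.add_apply, HilbertModule.inn_add_right, map_add]
  smul r S x y := by
    rw [HilbertModule.Adjointable.smul_apply, HilbertModule.inn_smul_right, map_smul]

/-- The representation `S ↦ S ⊙ id` of `𝓑ᵃ(E)` on `E ⊙ G`. -/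
noncomputable def adjointableRep : E.Adjointable →⋆ₐ[ℂ] (T.H →L[ℂ] T.H) :=
  T.toKernelDilation.act (isKernelAction_adjointable ι E)

theorem adjointableRep_L (S : E.Adjointable) (x : E) (g : G) :
    T.adjointableRep S (T.L x g) = T.L (S x) g :=
  T.toKernelDilation.act_L _ S x g

theorem inner_L_L (x y : E) (g h : G) : ⟪T.L x g, T.L y h⟫_ℂ = ⟪g, ι (E.inn x y) h⟫_ℂ :=
  T.toKernelDilation.inner_L_L x y g h

theorem L_injective (hι : Function.Injective ι) : Function.Injective T.L := by
  rw [injective_iff_map_eq_zero]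
  intro x hx
  have := T.adjoint_comp x x
  rw [hx, ContinuousLinearMap.comp_zero, eq_comm, ← map_zero ι] at this
  exact HilbertModule.inn_self_eq_zero.1 (hι this)

theorem adjointableRep_injective (hι : Function.Injective ι) :
    Function.Injective T.adjointableRep := by
  intro S S' h
  refine HilbertModule.Adjointable.ext' fun x => T.L_injective hι ?_
  ext g
  rw [← adjointableRep_L, ← adjointableRep_L, h]

end InteriorTensor
end InteriorTensor

/-! ### Complete positivity as positivity of the kernel `φ(c⋆ d)`. -/

section CompletelyPositive

set_option linter.unusedSectionVars false

/-- The points `x i` may coincide: the form is additive in each slot, so colliding indices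
contribute correctly. -/
theorem kernelForm_sum_single {X G : Type u} [NormedAddCommGroup G] [InnerProductSpace ℂ G]
    (K : X → X → G →L[ℂ] G) {n : Type*} [Fintype n] (x : n → X) (h : n → G) :
    kernelForm K (∑ i, Finsupp.single (x i) (h i)) = ∑ i, ∑ j, ⟪h i, K (x i) (x j) (h j)⟫_ℂ := by
  have e : ∀ y v, ((∑ i, Finsupp.single (x i) (h i)).sum fun z w => ⟪v, K y z w⟫_ℂ) =
      ∑ j, ⟪v, K y (x j) (h j)⟫_ℂ := fun y v => by
    rw [← Finsupp.sum_finsetSum_index (by simp) (by simp)]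
    simp
  rw [kernelForm]
  simp only [e]
  rw [← Finsupp.sum_finsetSum_index (by simp)
    (by simp [Finset.sum_add_distrib])]
  simp

theorem KernelDilation.kernelForm_eq {X G : Type u} [NormedAddCommGroup G] [InnerProductSpace ℂ G]
    [CompleteSpace G] {K : X → X → G →L[ℂ] G} (D : KernelDilation K) (f : X →₀ G) :
    kernelForm K f = ((‖D.total f‖ ^ 2 : ℝ) : ℂ) := by
  rw [Complex.ofReal_pow]
  exact (D.inner_total f f).symm.trans (inner_self_eq_norm_sq_to_K _)

variable {C B G : Type u} [CStarAlgebra C] [PartialOrder C] [StarOrderedRing C]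
  [CStarAlgebra B] [PartialOrder B] [StarOrderedRing B]
  [NormedAddCommGroup G] [InnerProductSpace ℂ G] [CompleteSpace G]

theorem CStarAlgebra.exists_eq_star_mul_self {c : C} (hc : 0 ≤ c) : ∃ d, c = star d * d :=
  CStarAlgebra.nonneg_iff_eq_star_mul_self.1 hc

theorem CStarMatrix.star_mul_nonneg {n : Type*} [Fintype n] [DecidableEq n] (c : n → C) :
    0 ≤ (CStarMatrix.ofMatrix fun i j => star (c i) * c j : CStarMatrix n n C) := by
  refine CStarMatrix.nonneg_of_forall ?_ fun b => ?_
  · ext i j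
    change star (star (c j) * c i) = star (c i) * c j
    rw [star_mul, star_star]
  · convert! star_mul_self_nonneg (∑ i, c i * b i) using 1
    simp only [star_sum, Finset.sum_mul_sum, star_mul]
    refine Finset.sum_congr rfl fun i _ => Finset.sum_congr rfl fun j _ => ?_
    change star (b i) * (star (c i) * c j) * b j = _
    simp only [mul_assoc]

theorem CompletelyPositiveMap.isPositiveKernel {ι : B →⋆ₐ[ℂ] (G →L[ℂ] G)}
    (hι : Function.Injective ι) (φ : C →CP B) :
    IsPositiveKernel fun c d : C => ι (φ (star c * d)) := by
  classical
  have h : ∀ {n : Type u} [Fintype n] [DecidableEq n] (c : n → C),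
      0 ≤ (CStarMatrix.ofMatrix fun i j => φ (star (c i) * c j) : CStarMatrix n n B) :=
    fun c => φ.map_cstarMatrix_nonneg _ (CStarMatrix.star_mul_nonneg c)
  refine isPositiveKernel_of_matrix_nonneg hι (k := fun c d => φ (star c * d)) (fun c d => ?_)
    fun s => h _
  -- Hermitian symmetry is an off-diagonal entry of the image of the positive 2 × 2 matrix built
  -- from `c` and `d`.
  have := (IsSelfAdjoint.of_nonneg (h fun i : ULift.{u} (Fin 2) => ![c, d] i.down)).star_eq
  exact congrFun (congrFun this ⟨1⟩) ⟨0⟩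

/-- A linear map all of whose forms `∑ ⟪g c, ψ (c⋆ d) (g d)⟫` are nonnegative is completely
positive. -/
def CompletelyPositiveMap.ofKernelForm {ι : B →⋆ₐ[ℂ] (G →L[ℂ] G)} (hι : Function.Injective ι)
    (ψ : C →ₗ[ℂ] B) (hψ : ∀ f, 0 ≤ kernelForm (fun c d : C => ι (ψ (star c * d))) f) : C →CP B where
  toLinearMap := ψ
  map_cstarMatrix_nonneg' k M hM := by
    obtain ⟨N, rfl⟩ := CStarAlgebra.exists_eq_star_mul_self hM
    refine (CStarMatrix.nonneg_iff hι _).2 fun h => ?_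
    -- For a positive matrix `N⋆ N`, each row `l` of `N` contributes one kernel form, at `∑ᵢ N l i ⊗
    -- h i`.
    have e : ∑ i, ∑ j, ⟪h i, ι ((CStarMatrix.map (star N * N) ψ) i j) (h j)⟫_ℂ =
        ∑ l, kernelForm (fun c d : C => ι (ψ (star c * d)))
          (∑ i, Finsupp.single (N l i) (h i)) := by
      simp only [kernelForm_sum_single, CStarMatrix.map_apply, CStarMatrix.mul_apply,
        CStarMatrix.star_apply, map_sum, _root_.sum_apply, inner_sum]
      rw [Finset.sum_comm]
      exact (Finset.sum_congr rfl fun y _ => Finset.sum_comm).trans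
        (Finset.sum_comm.trans (Finset.sum_congr rfl fun l _ => Finset.sum_comm))
    exact e ▸ Finset.sum_nonneg fun l _ => hψ _

end CompletelyPositive

/-! ### Hilbert modules realized as spaces of operators `G → H`. -/

section OperatorModule

set_option linter.unusedSectionVars false

variable {B G H : Type u} [CStarAlgebra B] [PartialOrder B] [StarOrderedRing B]
  [NormedAddCommGroup G] [InnerProductSpace ℂ G] [CompleteSpace G]
  [NormedAddCommGroup H] [InnerProductSpace ℂ H] [CompleteSpace H]

/-- A Hilbert module given by a Banach space with a right action `r` of `B` and an inner product `p`
that induces the norm. -/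
def HilbertModule.ofInner (E : Type u) [NormedAddCommGroup E] [NormedSpace ℂ E] [CompleteSpace E]
    (r : E → B → E) (p : E → E → B)
    (r_one : ∀ x, r x 1 = x) (r_mul : ∀ x b c, r x (b * c) = r (r x b) c)
    (r_add : ∀ x b c, r x (b + c) = r x b + r x c)
    (add_r : ∀ x y b, r (x + y) b = r x b + r y b)
    (p_add : ∀ x y z, p x (y + z) = p x y + p x z)
    (p_nonneg : ∀ x, 0 ≤ p x x)
    (p_r : ∀ x y b, p x (r y b) = p x y * b)
    (p_smul : ∀ (z : ℂ) x y, p x (z • y) = z • p x y)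
    (star_p : ∀ x y, star (p x y) = p y x)
    (norm_sq : ∀ x, ‖x‖ ^ 2 = ‖p x x‖) : HilbertModule B :=
  letI : Module Bᵐᵒᵖ E :=
    { smul := fun b x => r x b.unop
      one_smul := r_one
      mul_smul := fun b c x => r_mul x c.unop b.unop
      smul_zero := fun b => by
        have := add_r 0 0 b.unop
        rw [add_zero, left_eq_add] at this
        exact this
      smul_add := fun b x y => add_r x y b.unop
      add_smul := fun b c x => r_add x b.unop c.unop
      zero_smul := fun x => by
        have := r_add x 0 0
        rw [add_zero, left_eq_add] at this
        exact this }
  letI : CStarModule Bᵐᵒᵖ E :=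
    { inner := fun x y => op (p x y)
      inner_add_right := fun {x y z} => congrArg op (p_add x y z)
      inner_self_nonneg := fun {x} => p_nonneg x
      inner_self := fun {x} => by
        rw [op_eq_zero_iff, ← norm_eq_zero, ← norm_sq, sq_eq_zero_iff, norm_eq_zero]
      inner_op_smul_right := fun {b x y} => congrArg op (p_r x y b.unop)
      inner_smul_right_complex := fun {z x y} => congrArg op (p_smul z x y)
      star_inner := fun x y => congrArg op (star_p x y)
      norm_eq_sqrt_norm_inner_self := fun x => by
        rw [norm_op, ← norm_sq, Real.sqrt_sq (norm_nonneg _)] }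
  { carrier := E }

/-- A space of operators `G → H` that is a right module over `ι B` and whose products `x⋆ y` lie in
`ι B`. -/
structure IsOperatorModule (ι : B →⋆ₐ[ℂ] (G →L[ℂ] G)) (S : Submodule ℂ (G →L[ℂ] H)) : Prop where
  comp_mem : ∀ x ∈ S, ∀ b, x.comp (ι b) ∈ S
  adjoint_comp_mem : ∀ x ∈ S, ∀ y ∈ S, (ContinuousLinearMap.adjoint x).comp y ∈ Set.range ι

namespace IsOperatorModule

variable {ι : B →⋆ₐ[ℂ] (G →L[ℂ] G)} {S : Submodule ℂ (G →L[ℂ] H)}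

/-- The `B`-valued inner product of an operator module. -/
noncomputable def innerB (hS : IsOperatorModule ι S) (x y : S) : B :=
  (hS.adjoint_comp_mem _ x.2 _ y.2).choose

theorem ι_innerB (hS : IsOperatorModule ι S) (x y : S) :
    ι (hS.innerB x y) = (ContinuousLinearMap.adjoint x.1).comp y.1 :=
  (hS.adjoint_comp_mem _ x.2 _ y.2).choose_spec

theorem norm_sq_eq (hι : Function.Injective ι) (hS : IsOperatorModule ι S) (x : S) :
    ‖x‖ ^ 2 = ‖hS.innerB x x‖ := by
  rw [← NonUnitalStarAlgHom.norm_map ι hι, ι_innerB, ContinuousLinearMap.norm_adjoint_comp_self, sq]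
  rfl

/-- The Hilbert module given by a closed operator module. -/
noncomputable def hilbertModule (hι : Function.Injective ι) (hS : IsOperatorModule ι S)
    (hc : IsClosed (S : Set (G →L[ℂ] H))) : HilbertModule B :=
  have : CompleteSpace S := hc.completeSpace_coe
  HilbertModule.ofInner S (fun x b => ⟨x.1.comp (ι b), hS.comp_mem _ x.2 _⟩) hS.innerB
    (fun x => Subtype.ext <| by
      change x.1.comp (ι 1) = x.1
      rw [map_one]; rfl)
    (fun x b c => Subtype.ext <| by
      change x.1.comp (ι (b * c)) = (x.1.comp (ι b)).comp (ι c)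
      rw [map_mul]; rfl)
    (fun x b c => Subtype.ext <| by
      change x.1.comp (ι (b + c)) = x.1.comp (ι b) + x.1.comp (ι c)
      rw [map_add, ContinuousLinearMap.comp_add])
    (fun x y b => Subtype.ext <| ContinuousLinearMap.add_comp _ _ _)
    (fun x y z => hι <| by
      rw [map_add, ι_innerB, ι_innerB, ι_innerB]
      exact ContinuousLinearMap.comp_add _ _ _)
    (fun x => by
      rw [← StarAlgHom.nonneg_iff_of_injective ι hι, ι_innerB,
        ContinuousLinearMap.nonneg_iff_isPositive]
      exact ContinuousLinearMap.isPositive_adjoint_comp_self x.1)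
    (fun x y b => hι <| by
      rw [map_mul, ι_innerB, ι_innerB]
      rfl)
    (fun z x y => hι <| by
      rw [map_smul, ι_innerB, ι_innerB]
      exact ContinuousLinearMap.comp_smul _ _ _)
    (fun x y => hι <| by
      rw [map_star, ι_innerB, ι_innerB, ContinuousLinearMap.star_eq_adjoint,
        ContinuousLinearMap.adjoint_comp, ContinuousLinearMap.adjoint_adjoint])
    (hS.norm_sq_eq hι)

variable (hι : Function.Injective ι) (hS : IsOperatorModule ι S)
  (hc : IsClosed (S : Set (G →L[ℂ] H)))

/-- An element of the operator module as an element of the Hilbert module. -/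
def toElement (x : G →L[ℂ] H) (hx : x ∈ S) : hS.hilbertModule hι hc := ⟨x, hx⟩

/-- The underlying operators of the elements of the Hilbert module. -/
noncomputable def toOperator : hS.hilbertModule hι hc →L[ℂ] (G →L[ℂ] H) := S.subtypeL

theorem toOperator_mem (x : hS.hilbertModule hι hc) : hS.toOperator hι hc x ∈ S := x.2

theorem toOperator_toElement (x : G →L[ℂ] H) (hx : x ∈ S) :
    hS.toOperator hι hc (hS.toElement hι hc x hx) = x := rfl

theorem toOperator_injective : Function.Injective (hS.toOperator hι hc) := Subtype.val_injective

theorem ι_inn (x y : hS.hilbertModule hι hc) :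
    ι ((hS.hilbertModule hι hc).inn x y) =
      (ContinuousLinearMap.adjoint (hS.toOperator hι hc x)).comp (hS.toOperator hι hc y) :=
  hS.ι_innerB x y

theorem toOperator_rsmul (x : hS.hilbertModule hι hc) (b : B) :
    hS.toOperator hι hc ((hS.hilbertModule hι hc).rsmul x b) =
      (hS.toOperator hι hc x).comp (ι b) := rfl

/-- If the vectors `x g` are total in `H`, then `H` is the interior tensor product. -/
noncomputable def interiorTensor
    (hd : (Submodule.span ℂ {h : H | ∃ x ∈ S, ∃ g, x g = h}).topologicalClosure = ⊤) :
    InteriorTensor ι (hS.hilbertModule hι hc) where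
  H := H
  L := hS.toOperator hι hc
  adjoint_comp x y := (hS.ι_inn hι hc x y).symm
  dense := by
    rw [← hd]
    congr 2
    ext h
    exact ⟨fun ⟨x, g, h⟩ => ⟨x.1, x.2, g, h⟩, fun ⟨x, hx, g, h⟩ => ⟨⟨x, hx⟩, g, h⟩⟩

section Representation

variable {C : Type u} [CStarAlgebra C] (π : C →⋆ₐ[ℂ] (H →L[ℂ] H))
  (hπ : ∀ c, ∀ x ∈ S, (π c).comp x ∈ S)

/-- Left multiplication on an operator module by an operator that leaves it invariant. -/
noncomputable def leftMul (T : H →L[ℂ] H) (hT : ∀ x ∈ S, T.comp x ∈ S) :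
    hS.hilbertModule hι hc →L[ℂ] hS.hilbertModule hι hc :=
  (((ContinuousLinearMap.compL ℂ G H H T).comp S.subtypeL).codRestrict S fun x => hT x.1 x.2 :
    S →L[ℂ] S)

theorem toOperator_leftMul (T : H →L[ℂ] H) (hT : ∀ x ∈ S, T.comp x ∈ S)
    (x : hS.hilbertModule hι hc) :
    hS.toOperator hι hc (hS.leftMul hι hc T hT x) = T.comp (hS.toOperator hι hc x) := rfl

theorem inn_leftMul (c : C) (x y : hS.hilbertModule hι hc) :
    (hS.hilbertModule hι hc).inn (hS.leftMul hι hc (π (star c)) (hπ _) x) y =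
      (hS.hilbertModule hι hc).inn x (hS.leftMul hι hc (π c) (hπ _) y) := by
  refine hι ?_
  rw [ι_inn, ι_inn, toOperator_leftMul, toOperator_leftMul, ContinuousLinearMap.adjoint_comp,
    ContinuousLinearMap.comp_assoc, map_star, ContinuousLinearMap.star_eq_adjoint,
    ContinuousLinearMap.adjoint_adjoint]

/-- The representation by adjointable operators on an operator module given by a representation
on `H` that leaves it invariant. -/
noncomputable def leftRep : C →⋆ₐ[ℂ] (hS.hilbertModule hι hc).Adjointable where
  toFun c := ⟨hS.leftMul hι hc (π c) (hπ c), hS.leftMul hι hc (π (star c)) (hπ _),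
    hS.inn_leftMul hι hc π hπ c⟩
  map_one' := HilbertModule.Adjointable.ext' fun x => hS.toOperator_injective hι hc <| by
    change (π 1).comp x.1 = x.1
    rw [map_one]; rfl
  map_mul' c d := HilbertModule.Adjointable.ext' fun x => hS.toOperator_injective hι hc <| by
    change (π (c * d)).comp x.1 = (π c).comp ((π d).comp x.1)
    rw [map_mul]; rfl
  map_zero' := HilbertModule.Adjointable.ext' fun x => hS.toOperator_injective hι hc <| by
    change (π 0).comp x.1 = 0
    rw [map_zero, ContinuousLinearMap.zero_comp]
  map_add' c d := HilbertModule.Adjointable.ext' fun x => hS.toOperator_injective hι hc <| by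
    change (π (c + d)).comp x.1 = (π c).comp x.1 + (π d).comp x.1
    rw [map_add, ContinuousLinearMap.add_comp]
  commutes' r := HilbertModule.Adjointable.ext' fun x => hS.toOperator_injective hι hc <| by
    change (π (algebraMap ℂ C r)).comp x.1 = r • x.1
    rw [AlgHomClass.commutes, Algebra.algebraMap_eq_smul_one]; rfl
  map_star' c := HilbertModule.Adjointable.eq_star (hS.inn_leftMul hι hc π hπ c)

theorem toOperator_leftRep (c : C) (x : hS.hilbertModule hι hc) :
    hS.toOperator hι hc (hS.leftRep hι hc π hπ c x) = (π c).comp (hS.toOperator hι hc x) := rfl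

end Representation

end IsOperatorModule
end OperatorModule

/-! ### The operator module generated by a family of operators. -/

section OperatorSpan

set_option linter.unusedSectionVars false

variable {B G H : Type u} [CStarAlgebra B] [PartialOrder B] [StarOrderedRing B]
  [NormedAddCommGroup G] [InnerProductSpace ℂ G] [CompleteSpace G]
  [NormedAddCommGroup H] [InnerProductSpace ℂ H] [CompleteSpace H]

/-- The space of operators spanned by `(L x) (ι b)`. -/
def operatorSpan {X : Type*} (ι : B →⋆ₐ[ℂ] (G →L[ℂ] G)) (L : X → G →L[ℂ] H) :
    Submodule ℂ (G →L[ℂ] H) :=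
  Submodule.span ℂ {y | ∃ x b, y = (L x).comp (ι b)}

variable {X : Type*} {ι : B →⋆ₐ[ℂ] (G →L[ℂ] G)} {L : X → G →L[ℂ] H}

theorem comp_mem_operatorSpan (x : X) (b : B) : (L x).comp (ι b) ∈ operatorSpan ι L :=
  Submodule.subset_span ⟨x, b, rfl⟩

theorem mem_operatorSpan (x : X) : L x ∈ operatorSpan ι L := by
  have := comp_mem_operatorSpan (ι := ι) (L := L) x 1
  rw [map_one] at this
  exact this

theorem comp_mem_of_mem_operatorSpan {y : G →L[ℂ] H} (hy : y ∈ operatorSpan ι L) (b : B) :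
    y.comp (ι b) ∈ operatorSpan ι L := by
  induction hy using Submodule.span_induction with
  | mem y hy =>
    obtain ⟨x, c, rfl⟩ := hy
    rw [ContinuousLinearMap.comp_assoc, ← ContinuousLinearMap.mul_def, ← map_mul]
    exact comp_mem_operatorSpan x _
  | zero => rw [ContinuousLinearMap.zero_comp]; exact zero_mem _
  | add y z _ _ hy hz => rw [ContinuousLinearMap.add_comp]; exact add_mem hy hz
  | smul r y _ hy => rw [ContinuousLinearMap.smul_comp]; exact Submodule.smul_mem _ _ hy

theorem left_comp_mem_operatorSpan {T : H →L[ℂ] H} (hT : ∀ x, T.comp (L x) ∈ operatorSpan ι L)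
    {y : G →L[ℂ] H} (hy : y ∈ operatorSpan ι L) : T.comp y ∈ operatorSpan ι L := by
  induction hy using Submodule.span_induction with
  | mem y hy =>
    obtain ⟨x, c, rfl⟩ := hy
    rw [← ContinuousLinearMap.comp_assoc]
    exact comp_mem_of_mem_operatorSpan (hT x) c
  | zero => rw [ContinuousLinearMap.comp_zero]; exact zero_mem _
  | add y z _ _ hy hz => rw [ContinuousLinearMap.comp_add]; exact add_mem hy hz
  | smul r y _ hy => rw [ContinuousLinearMap.comp_smul]; exact Submodule.smul_mem _ _ hy

theorem isOperatorModule_operatorSpan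
    (hL : ∀ x y, (ContinuousLinearMap.adjoint (L x)).comp (L y) ∈ Set.range ι) :
    IsOperatorModule ι (operatorSpan ι L) where
  comp_mem y hy b := comp_mem_of_mem_operatorSpan hy b
  adjoint_comp_mem y hy z hz := by
    change _ ∈ LinearMap.range (ι.toAlgHom.toLinearMap)
    induction hy, hz using Submodule.span_induction₂ with
    | mem_mem y z hy hz =>
      obtain ⟨x, b, rfl⟩ := hy
      obtain ⟨x', b', rfl⟩ := hz
      obtain ⟨c, hc⟩ := hL x x'
      refine ⟨star b * c * b', ?_⟩
      change ι _ = _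
      rw [map_mul, map_mul, hc, map_star, ContinuousLinearMap.star_eq_adjoint,
        ContinuousLinearMap.adjoint_comp]
      rfl
    | zero_left z hz => rw [map_zero, ContinuousLinearMap.zero_comp]; exact zero_mem _
    | zero_right z hz => rw [ContinuousLinearMap.comp_zero]; exact zero_mem _
    | add_left x y z _ _ _ hx hy =>
      rw [map_add, ContinuousLinearMap.add_comp]; exact add_mem hx hy
    | add_right x y z _ _ _ hx hy => rw [ContinuousLinearMap.comp_add]; exact add_mem hx hy
    | smul_left r x y _ _ h =>
      rw [map_smulₛₗ, ContinuousLinearMap.smul_comp]; exact Submodule.smul_mem _ _ h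
    | smul_right r x y _ _ h =>
      rw [ContinuousLinearMap.comp_smul]; exact Submodule.smul_mem _ _ h

end OperatorSpan

/-! ### Strong closures of operator modules. -/

section StrongClosure

set_option linter.unusedSectionVars false

variable {B G H : Type u} [CStarAlgebra B] [PartialOrder B] [StarOrderedRing B]
  [NormedAddCommGroup G] [InnerProductSpace ℂ G] [CompleteSpace G]
  [NormedAddCommGroup H] [InnerProductSpace ℂ H] [CompleteSpace H]

variable (G H) in
/-- The identity from the norm topology to the strong operator topology. -/
noncomputable abbrev toStrong : (G →L[ℂ] H) →L[ℂ] (G →Lₚₜ[ℂ] H) :=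
  ContinuousLinearMap.toPointwiseConvergenceCLM ℂ (RingHom.id ℂ) G H

/-- The closure of a space of operators in the strong operator topology. -/
noncomputable def strongClosure (S : Submodule ℂ (G →L[ℂ] H)) : Submodule ℂ (G →L[ℂ] H) :=
  ((S.map (toStrong G H).toLinearMap).topologicalClosure).comap (toStrong G H).toLinearMap

theorem mem_strongClosure {S : Submodule ℂ (G →L[ℂ] H)} {x : G →L[ℂ] H} :
    x ∈ strongClosure S ↔ toStrong G H x ∈ closure (toStrong G H '' S) := Iff.rfl

theorem isClosed_strongClosure (S : Submodule ℂ (G →L[ℂ] H)) :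
    IsClosed (strongClosure S : Set (G →L[ℂ] H)) :=
  IsClosed.preimage (toStrong G H).continuous isClosed_closure

theorem toStrong_image_strongClosure (S : Submodule ℂ (G →L[ℂ] H)) :
    (toStrong G H '' strongClosure S : Set (G →Lₚₜ[ℂ] H)) = closure (toStrong G H '' S) :=
  Set.image_preimage_eq _ fun x => ⟨x, rfl⟩

theorem le_strongClosure (S : Submodule ℂ (G →L[ℂ] H)) : S ≤ strongClosure S :=
  fun _ hx => mem_strongClosure.2 (subset_closure ⟨_, hx, rfl⟩)

theorem topologicalClosure_le_strongClosure (S : Submodule ℂ (G →L[ℂ] H)) :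
    S.topologicalClosure ≤ strongClosure S :=
  S.topologicalClosure_minimal (le_strongClosure S) (isClosed_strongClosure S)

/-- `N` is its own bicommutant. Written with matrix coefficients, commutation with the commutant
becomes a family of equations that are preserved by weak operator limits. -/
theorem VonNeumannAlgebra.mem_iff_inner {N : VonNeumannAlgebra G} {T : G →L[ℂ] G} :
    T ∈ N ↔ ∀ t ∈ N.commutant, ∀ g h,
      ⟪h, T (t g)⟫_ℂ = ⟪ContinuousLinearMap.adjoint t h, T g⟫_ℂ := by
  conv_lhs => rw [← N.commutant_commutant, VonNeumannAlgebra.mem_commutant_iff]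
  refine forall₂_congr fun t _ => ⟨fun h g k => ?_, fun h => ?_⟩
  · rw [ContinuousLinearMap.adjoint_inner_left]
    exact congrArg _ (DFunLike.congr_fun h g).symm
  · ext g
    refine ext_inner_left ℂ fun k => ?_
    rw [mul_apply_eq_comp, mul_apply_eq_comp, h, ContinuousLinearMap.adjoint_inner_left]

/-- The adjoint is not strongly continuous, but the coefficients `⟪x h, y g⟫` of `x⋆ y` are strongly
continuous in `x` and in `y` separately. The commutation relations therefore extend to the closure
one variable at a time. -/
theorem adjoint_comp_mem_of_mem_strongClosure {N : VonNeumannAlgebra G}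
    {S : Submodule ℂ (G →L[ℂ] H)}
    (hS : ∀ x ∈ S, ∀ y ∈ S, (ContinuousLinearMap.adjoint x).comp y ∈ N)
    {x y : G →L[ℂ] H} (hx : x ∈ strongClosure S) (hy : y ∈ strongClosure S) :
    (ContinuousLinearMap.adjoint x).comp y ∈ N := by
  let p : (G →L[ℂ] H) → (G →L[ℂ] H) → Prop := fun x y =>
    ∀ t ∈ N.commutant, ∀ g h, ⟪x h, y (t g)⟫_ℂ = ⟪x (ContinuousLinearMap.adjoint t h), y g⟫_ℂ
  have hp : ∀ x y, p x y ↔ (ContinuousLinearMap.adjoint x).comp y ∈ N := fun x y => by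
    rw [VonNeumannAlgebra.mem_iff_inner]
    simp only [p, ContinuousLinearMap.comp_apply, ContinuousLinearMap.adjoint_inner_right]
  have hev : ∀ g, Continuous fun z : G →Lₚₜ[ℂ] H => z g := fun g =>
    (PointwiseConvergenceCLM.evalCLM (RingHom.id ℂ) H g).continuous
  -- First `y` is a limit while `x` stays in `S`; afterwards `x` is a limit with this `y` fixed.
  have h1 : ∀ x ∈ S, p x y := fun x hx => by
    refine closure_minimal (s := toStrong G H '' S) (t := {z : G →Lₚₜ[ℂ] H | ∀ t ∈ N.commutant,
      ∀ g h, ⟪x h, z (t g)⟫_ℂ = ⟪x (ContinuousLinearMap.adjoint t h), z g⟫_ℂ}) ?_ ?_ hy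
    · rintro _ ⟨z, hz, rfl⟩
      exact (hp x z).2 (hS x hx z hz)
    · simp only [Set.ofPred_forall]
      exact isClosed_iInter fun t => isClosed_iInter fun _ => isClosed_iInter fun g =>
        isClosed_iInter fun h => isClosed_eq (continuous_const.inner (hev _))
          (continuous_const.inner (hev _))
  refine (hp x y).1 (closure_minimal (s := toStrong G H '' S) (t := {z : G →Lₚₜ[ℂ] H |
      ∀ t ∈ N.commutant, ∀ g h, ⟪z h, y (t g)⟫_ℂ =
        ⟪z (ContinuousLinearMap.adjoint t h), y g⟫_ℂ}) ?_ ?_ hx)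
  · rintro _ ⟨z, hz, rfl⟩
    exact h1 z hz
  · simp only [Set.ofPred_forall]
    exact isClosed_iInter fun t => isClosed_iInter fun _ => isClosed_iInter fun g =>
      isClosed_iInter fun h => isClosed_eq ((hev _).inner continuous_const)
        ((hev _).inner continuous_const)

variable {ι : B →⋆ₐ[ℂ] (G →L[ℂ] G)} {N : VonNeumannAlgebra G} {S : Submodule ℂ (G →L[ℂ] H)}

namespace IsOperatorModule

theorem strongClosure (hS : IsOperatorModule ι S)
    (hN : Set.range ι = (N : Set (G →L[ℂ] G))) : IsOperatorModule ι (strongClosure S) where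
  comp_mem x hx b := by
    refine map_mem_closure (f := PointwiseConvergenceCLM.precomp H (ι b)) (s := toStrong G H '' S)
      (t := toStrong G H '' S) (PointwiseConvergenceCLM.precomp H (ι b)).continuous
      (mem_strongClosure.1 hx) ?_
    rintro _ ⟨y, hy, rfl⟩
    exact ⟨_, hS.comp_mem y hy b, rfl⟩
  adjoint_comp_mem x hx y hy := by
    have hS' := hS.adjoint_comp_mem
    rw [hN] at hS' ⊢
    exact adjoint_comp_mem_of_mem_strongClosure hS' hx hy

theorem topologicalClosure (hS : IsOperatorModule ι S)
    (hN : Set.range ι = (N : Set (G →L[ℂ] G))) : IsOperatorModule ι S.topologicalClosure where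
  comp_mem _ hx b :=
    map_mem_closure (f := (ContinuousLinearMap.compL ℂ G G H).flip (ι b))
      ((ContinuousLinearMap.compL ℂ G G H).flip (ι b)).continuous hx fun y hy =>
      hS.comp_mem y hy b
  adjoint_comp_mem _ hx _ hy := (hS.strongClosure hN).adjoint_comp_mem _
    (topologicalClosure_le_strongClosure S hx) _ (topologicalClosure_le_strongClosure S hy)

end IsOperatorModule

theorem left_comp_mem_strongClosure {T : H →L[ℂ] H} (hT : ∀ x ∈ S, T.comp x ∈ S) :
    ∀ x ∈ strongClosure S, T.comp x ∈ strongClosure S := fun x hx => by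
  refine map_mem_closure (f := PointwiseConvergenceCLM.postcomp G T) (s := toStrong G H '' S)
    (t := toStrong G H '' S) (PointwiseConvergenceCLM.postcomp G T).continuous
    (mem_strongClosure.1 hx) ?_
  rintro _ ⟨y, hy, rfl⟩
  exact ⟨_, hT y hy, rfl⟩

theorem left_comp_mem_topologicalClosure {T : H →L[ℂ] H} (hT : ∀ x ∈ S, T.comp x ∈ S) :
    ∀ x ∈ S.topologicalClosure, T.comp x ∈ S.topologicalClosure := fun _ hx =>
  map_mem_closure (ContinuousLinearMap.compL ℂ G H H T).continuous hx hT

end StrongClosure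

/-! ### Existence of minimal Stinespring modules of both kinds. -/

section MinimalModules

set_option linter.unusedSectionVars false

variable {C B G : Type u} [CStarAlgebra C] [PartialOrder C] [StarOrderedRing C]
  [CStarAlgebra B] [PartialOrder B] [StarOrderedRing B]
  [NormedAddCommGroup G] [InnerProductSpace ℂ G] [CompleteSpace G]
  {ι : B →⋆ₐ[ℂ] (G →L[ℂ] G)} {N : VonNeumannAlgebra G}

theorem CompletelyPositiveMap.isKernelAction_mul (ι : B →⋆ₐ[ℂ] (G →L[ℂ] G)) (φ : C →CP B) :
    IsKernelAction (fun c d : C => ι (φ (star c * d))) fun (e c : C) => e * c where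
  one := one_mul
  mul := mul_assoc
  adjoint e c d := by rw [star_mul, mul_assoc]
  add e e' c d := by rw [add_mul, mul_add, map_add, map_add]
  smul r e c d := by rw [smul_mul_assoc, mul_smul_comm, map_smul, map_smul]

namespace StinespringModule

variable {φ : C →CP B} (D : KernelDilation fun c d : C => ι (φ (star c * d)))

/-- The Stinespring representation. -/
noncomputable abbrev dilationRep : C →⋆ₐ[ℂ] (D.H →L[ℂ] D.H) :=
  D.act (φ.isKernelAction_mul ι)

theorem dilationRep_comp_L (c d : C) : (dilationRep D c).comp (D.L d) = D.L (c * d) :=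
  ContinuousLinearMap.ext fun g => D.act_L _ c d g

theorem isOperatorModule_dilation : IsOperatorModule ι (operatorSpan ι D.L) :=
  isOperatorModule_operatorSpan fun c d => ⟨_, (D.adjoint_comp c d).symm⟩

theorem dilationRep_comp_mem (c : C) :
    ∀ x ∈ operatorSpan ι D.L, (dilationRep D c).comp x ∈ operatorSpan ι D.L :=
  fun _ hx => left_comp_mem_operatorSpan
    (fun d => by rw [dilationRep_comp_L]; exact mem_operatorSpan _) hx

variable (hι : Function.Injective ι) {S : Submodule ℂ (G →L[ℂ] D.H)} (hS : IsOperatorModule ι S)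
  (hc : IsClosed (S : Set (G →L[ℂ] D.H))) (hle : operatorSpan ι D.L ≤ S)
  (hπ : ∀ c, ∀ x ∈ S, (dilationRep D c).comp x ∈ S)

/-- The Stinespring module given by a closed operator module that is invariant under the Stinespring
representation. -/
noncomputable def ofOperatorModule : StinespringModule φ where
  E := hS.hilbertModule hι hc
  σ := hS.leftRep hι hc (dilationRep D) hπ
  x := hS.toElement hι hc (D.L 1) (hle (mem_operatorSpan 1))
  eq c := hι <| by
    rw [hS.ι_inn, hS.toOperator_leftRep, hS.toOperator_toElement, dilationRep_comp_L, mul_one,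
      D.adjoint_comp, star_one, one_mul]

/-- The span of `C x B`, as a subspace of the Hilbert module of `ofOperatorModule`. -/
noncomputable def operatorSpanCxB : Submodule ℂ (hS.hilbertModule hι hc) :=
  Submodule.span ℂ {y | ∃ (c : C) (b : B), y = (hS.hilbertModule hι hc).rsmul
    (hS.leftRep hι hc (dilationRep D) hπ c
      (hS.toElement hι hc (D.L 1) (hle (mem_operatorSpan 1)))) b}

/-- With the cyclic vector `L 1`, the generator `c x b` is the operator `π(c) (L 1) (ι b) = (L c) (ι
b)`. -/
theorem image_operatorSpanCxB :
    hS.toOperator hι hc '' (operatorSpanCxB D hι hS hc hle hπ) =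
      (operatorSpan ι D.L : Set (G →L[ℂ] D.H)) := by
  have h : (operatorSpanCxB D hι hS hc hle hπ).map (hS.toOperator hι hc).toLinearMap =
      operatorSpan ι D.L := by
    rw [operatorSpanCxB, Submodule.map_span, operatorSpan]
    congr 1
    ext y
    have key : ∀ c b, hS.toOperator hι hc ((hS.hilbertModule hι hc).rsmul
        (hS.leftRep hι hc (dilationRep D) hπ c
          (hS.toElement hι hc (D.L 1) (hle (mem_operatorSpan 1)))) b) = (D.L c).comp (ι b) := by
      intro c b
      rw [hS.toOperator_rsmul, hS.toOperator_leftRep, hS.toOperator_toElement, dilationRep_comp_L,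
        mul_one]
    constructor
    · rintro ⟨_, ⟨c, b, rfl⟩, rfl⟩
      exact ⟨c, b, key c b⟩
    · rintro ⟨c, b, rfl⟩
      exact ⟨_, ⟨c, b, rfl⟩, key c b⟩
  exact congrArg SetLike.coe h

theorem dense_of_operatorSpan_le {S : Submodule ℂ (G →L[ℂ] D.H)} (hle : operatorSpan ι D.L ≤ S) :
    (Submodule.span ℂ {h : D.H | ∃ x ∈ S, ∃ g, x g = h}).topologicalClosure = ⊤ := by
  refine top_le_iff.1 (D.dense.ge.trans (Submodule.topologicalClosure_mono
    (Submodule.span_mono ?_)))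
  rintro _ ⟨c, g, rfl⟩
  exact ⟨D.L c, hle (mem_operatorSpan c), g, rfl⟩

end StinespringModule

open StinespringModule

theorem CompletelyPositiveMap.exists_isMinimal (hι : Function.Injective ι)
    (hN : Set.range ι = (N : Set (G →L[ℂ] G))) (φ : C →CP B) :
    ∃ D : StinespringModule φ, D.IsMinimal := by
  obtain ⟨D⟩ := (φ.isPositiveKernel hι).nonempty_dilation
  have hS := (isOperatorModule_dilation D).topologicalClosure hN
  have hc := (operatorSpan ι D.L).isClosed_topologicalClosure
  have hπ := fun c => left_comp_mem_topologicalClosure (dilationRep_comp_mem D c)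
  have hle := (operatorSpan ι D.L).le_topologicalClosure
  refine ⟨ofOperatorModule D hι hS hc hle hπ, ?_⟩
  have hind : Topology.IsInducing (hS.toOperator hι hc) := Topology.IsInducing.subtypeVal
  have hdense : Dense (operatorSpanCxB D hι hS hc hle hπ : Set (hS.hilbertModule hι hc)) := by
    intro y
    rw [hind.closure_eq_preimage_closure_image, image_operatorSpanCxB]
    exact hS.toOperator_mem hι hc y
  exact Submodule.dense_iff_topologicalClosure_eq_top.1 hdense

/-- For the strong closure of the operator span, the dilation space `H` is itself the interior
tensor product. The strong topology of the module is then that of `𝓑(G, H)`, so closedness and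
density hold by construction. -/
theorem CompletelyPositiveMap.exists_isStronglyMinimal (hι : Function.Injective ι)
    (hN : Set.range ι = (N : Set (G →L[ℂ] G))) (φ : C →CP B) :
    ∃ D : StinespringModule φ, D.IsStronglyMinimal ι := by
  obtain ⟨D⟩ := (φ.isPositiveKernel hι).nonempty_dilation
  have hS := (isOperatorModule_dilation D).strongClosure hN
  have hc := isClosed_strongClosure (operatorSpan ι D.L)
  have hπ := fun c => left_comp_mem_strongClosure (dilationRep_comp_mem D c)
  have hle := le_strongClosure (operatorSpan ι D.L)
  have hd := dense_of_operatorSpan_le D hle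
  let T := hS.interiorTensor hι hc hd
  have himage : ∀ Y : Set (hS.hilbertModule hι hc),
      T.strongImage Y = toStrong G D.H '' (hS.toOperator hι hc '' Y) := fun Y =>
    (Set.image_image _ _ _).symm
  have huniv : T.strongImage Set.univ = closure (toStrong G D.H '' operatorSpan ι D.L) := by
    rw [himage, ← toStrong_image_strongClosure, Set.image_univ]
    congr 1
    exact Subtype.range_coe
  have hclosed : IsClosed (T.strongImage Set.univ) := huniv ▸ isClosed_closure
  have hdense : T.strongImage Set.univ ⊆
      closure (T.strongImage (operatorSpanCxB D hι hS hc hle hπ)) := by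
    rw [huniv, himage, image_operatorSpanCxB]
    exact fun _ h => h
  exact ⟨ofOperatorModule D hι hS hc hle hπ, ⟨T, hclosed⟩, T, hdense⟩

end MinimalModules

/-! ### The universal property of the full free product. -/

section UniversalProperty

variable {A D H : Type u} [CStarAlgebra A] [CStarAlgebra D]
  [NormedAddCommGroup H] [InnerProductSpace ℂ H] [CompleteSpace H]

namespace AlgFreeProduct

/-- The `*`-homomorphism on the algebraic free product defined by two `*`-homomorphisms. -/
noncomputable def starLift (σ : Fin 2 → A →⋆ₐ[ℂ] D) : AlgFreeProduct A →⋆ₐ[ℂ] D :=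
  { lift fun i => (σ i).toAlgHom with
    map_star' := fun c => by
      change lift (fun i => (σ i).toAlgHom) (star c) = star (lift (fun i => (σ i).toAlgHom) c)
      induction c using induction with
      | hC r => rw [← algebraMap_star_comm, AlgHom.commutes, AlgHom.commutes, algebraMap_star_comm]
      | hi i a =>
        rw [star_incl, lift_incl, lift_incl]
        exact map_star (σ i) a
      | hadd c d hc hd => rw [star_add, map_add, map_add, hc, hd, star_add]
      | hmul c d hc hd => rw [star_mul, map_mul, map_mul, hc, hd, star_mul] }

theorem starLift_incl (σ : Fin 2 → A →⋆ₐ[ℂ] D) (i : Fin 2) (a : A) :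
    starLift σ (incl i a) = σ i a :=
  lift_incl (fun i => (σ i).toAlgHom) i a

/-- Followed by a faithful representation of `D`, the lift is one of the representations over which
the norm of the free product is a supremum. -/
theorem norm_starLift_le {ρ : D →⋆ₐ[ℂ] (H →L[ℂ] H)} (hρ : Function.Injective ρ)
    (σ : Fin 2 → A →⋆ₐ[ℂ] D) (c : AlgFreeProduct A) : ‖starLift σ c‖ ≤ ‖c‖ := by
  rw [← NonUnitalStarAlgHom.norm_map ρ hρ]
  exact le_repNorm { H := H, π := ρ.comp (starLift σ) } c

end AlgFreeProduct

namespace FullFreeProduct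

open AlgFreeProduct

/-- The universal property of the full free product. -/
theorem exists_lift {π : D →⋆ₐ[ℂ] (H →L[ℂ] H)} (hπ : Function.Injective π)
    (σ : Fin 2 → A →⋆ₐ[ℂ] D) : ∃ τ : FullFreeProduct A →⋆ₐ[ℂ] D, ∀ i a, τ (FullFreeProduct.ρ i a) = σ i a := by
  have hu : UniformContinuous (starLift σ) :=
    AddMonoidHomClass.uniformContinuous_of_bound (starLift σ) 1 fun c => by
      rw [one_mul]
      exact norm_starLift_le hπ σ c
  let f : FullFreeProduct A → D := Completion.extension (starLift σ)
  have hf : Continuous f := Completion.continuous_extension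
  have hc : ∀ c, f (ofAlg c) = starLift σ c := fun c => Completion.extension_coe hu c
  refine ⟨{ toFun := f, map_one' := ?_, map_mul' := ?_, map_zero' := ?_, map_add' := ?_,
            commutes' := ?_, map_star' := ?_ }, fun i a => ?_⟩
  · exact (hc 1).trans (map_one _)
  · intro c d
    refine denseRange_ofAlg.induction_on₂ (isClosed_eq (by fun_prop) (by fun_prop))
      (fun c d => ?_) c d
    rw [← ofAlg_mul, hc, hc, hc, map_mul]
  · exact (hc 0).trans (map_zero _)
  · intro c d
    refine denseRange_ofAlg.induction_on₂ (isClosed_eq (by fun_prop) (by fun_prop))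
      (fun c d => ?_) c d
    rw [← ofAlg_add, hc, hc, hc, map_add]
  · intro r
    exact (hc (algebraMap ℂ _ r)).trans (AlgHomClass.commutes (starLift σ) r)
  · intro c
    refine denseRange_ofAlg.induction_on c (isClosed_eq (by fun_prop) (by fun_prop))
      fun c => ?_
    rw [← ofAlg_star, hc, hc, map_star]
  · exact (hc _).trans (starLift_incl σ i a)

end FullFreeProduct
end UniversalProperty

/-! ### Completely positive maps given by vectors of Hilbert modules. -/

section VectorMap

set_option linter.unusedSectionVars false

variable {C B G : Type u} [CStarAlgebra C] [PartialOrder C] [StarOrderedRing C]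
  [CStarAlgebra B] [PartialOrder B] [StarOrderedRing B]
  [NormedAddCommGroup G] [InnerProductSpace ℂ G] [CompleteSpace G]
  {ι : B →⋆ₐ[ℂ] (G →L[ℂ] G)}

theorem IsPositiveKernel.zero_le_form {X : Type u} {K : X → X → G →L[ℂ] G}
    (hK : IsPositiveKernel K) (f : X →₀ G) : 0 ≤ kernelForm K f := by
  obtain ⟨D⟩ := hK.nonempty_dilation
  rw [D.kernelForm_eq, Complex.zero_le_real]
  positivity

/-- The kernel of `c ↦ ⟨x, σ(c) x⟩` factors as `(L (σ c x))⋆ (L (σ d x))`. -/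
theorem HilbertModule.exists_completelyPositive (hι : Function.Injective ι) {E : HilbertModule B}
    (σ : C →⋆ₐ[ℂ] E.Adjointable) (x : E) : ∃ φ : C →CP B, ∀ c, φ c = E.inn x (σ c x) := by
  let ψ : C →ₗ[ℂ] B :=
    { toFun := fun c => E.inn x (σ c x)
      map_add' := fun c d => by
        rw [map_add, HilbertModule.Adjointable.add_apply, HilbertModule.inn_add_right]
      map_smul' := fun r c => by
        rw [map_smul, HilbertModule.Adjointable.smul_apply, HilbertModule.inn_smul_right,
          RingHom.id_apply] }
  obtain ⟨T⟩ := InteriorTensor.nonempty hι E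
  refine ⟨CompletelyPositiveMap.ofKernelForm hι ψ fun f => ?_, fun c => rfl⟩
  have e : (fun c d : C => ι (ψ (star c * d))) = fun c d =>
      (ContinuousLinearMap.adjoint (T.L (σ c x))).comp (T.L (σ d x)) := by
    ext c d : 2
    rw [T.adjoint_comp]
    change ι (E.inn x (σ (star c * d) x)) = _
    rw [map_mul, map_star, HilbertModule.Adjointable.mul_apply,
      HilbertModule.Adjointable.inn_star_right]
  rw [e]
  exact (isPositiveKernel_of_adjoint_comp _).zero_le_form f

end VectorMap

/-! ### Existence of a joint representation tuple. -/

section JointRepresentation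

set_option linter.unusedSectionVars false

variable {A B G : Type u} [CStarAlgebra A] [PartialOrder A] [StarOrderedRing A]
  [CStarAlgebra B] [PartialOrder B] [StarOrderedRing B]
  [NormedAddCommGroup G] [InnerProductSpace ℂ G] [CompleteSpace G]
  {ι : B →⋆ₐ[ℂ] (G →L[ℂ] G)} {N : VonNeumannAlgebra G}

/-- The block diagonal kernel `φ₁(a⋆ b) ⊕ φ₂(a⋆ b)` on two copies of `A`. -/
noncomputable def sumKernel (φ₁ φ₂ : A →CP B) : A ⊕ A → A ⊕ A → B
  | .inl a, .inl b => φ₁ (star a * b)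
  | .inr a, .inr b => φ₂ (star a * b)
  | .inl _, .inr _ => 0
  | .inr _, .inl _ => 0

/-- Each diagonal block is a Gram kernel: the dilation of one map, extended by zero to the other
copy of `A`. -/
theorem isPositiveKernel_sumKernel (hι : Function.Injective ι) (φ₁ φ₂ : A →CP B) :
    IsPositiveKernel fun x y => ι (sumKernel φ₁ φ₂ x y) := by
  obtain ⟨D₁⟩ := (φ₁.isPositiveKernel hι).nonempty_dilation
  obtain ⟨D₂⟩ := (φ₂.isPositiveKernel hι).nonempty_dilation
  convert! (isPositiveKernel_of_adjoint_comp (Sum.elim D₁.L fun _ : A => 0)).add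
    (isPositiveKernel_of_adjoint_comp (Sum.elim (fun _ : A => 0) D₂.L)) using 3 with x y
  rcases x with a | a <;> rcases y with b | b <;>
    simp [sumKernel, D₁.adjoint_comp, D₂.adjoint_comp]

theorem isKernelAction_sumKernel (ι : B →⋆ₐ[ℂ] (G →L[ℂ] G)) (φ₁ φ₂ : A →CP B) :
    IsKernelAction (fun x y => ι (sumKernel φ₁ φ₂ x y))
      fun (a : A) => Sum.map (a * ·) (a * ·) where
  one x := by rcases x with b | b <;> simp
  mul a c x := by rcases x with b | b <;> simp [mul_assoc]
  adjoint c x y := by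
    rcases x with a | a <;> rcases y with b | b <;> simp [sumKernel, mul_assoc]
  add c d x y := by
    rcases x with a | a <;> rcases y with b | b <;> simp [sumKernel, add_mul, mul_add]
  smul r c x y := by
    rcases x with a | a <;> rcases y with b | b <;> simp [sumKernel]

theorem isSelfAdjoint_one_sub_comp_adjoint {H : Type*} [NormedAddCommGroup H]
    [InnerProductSpace ℂ H] [CompleteSpace H] (u : G →L[ℂ] H) :
    IsSelfAdjoint (1 - u.comp (ContinuousLinearMap.adjoint u) : H →L[ℂ] H) := by
  refine (IsSelfAdjoint.one _).sub ?_
  rw [IsSelfAdjoint, ContinuousLinearMap.star_eq_adjoint, ContinuousLinearMap.adjoint_comp,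
    ContinuousLinearMap.adjoint_adjoint]

/-- Since `u⋆ u = 2`, the operator `u u⋆` is twice a projection, and `1 - u u⋆` is a reflection. -/
theorem one_sub_mem_unitary {H : Type*} [NormedAddCommGroup H] [InnerProductSpace ℂ H]
    [CompleteSpace H] {u : G →L[ℂ] H}
    (hu : (ContinuousLinearMap.adjoint u).comp u = 1 + 1) :
    (1 - u.comp (ContinuousLinearMap.adjoint u) : H →L[ℂ] H) ∈ unitary (H →L[ℂ] H) := by
  have hs := (isSelfAdjoint_one_sub_comp_adjoint u).star_eq
  have hpp : u.comp (ContinuousLinearMap.adjoint u) * u.comp (ContinuousLinearMap.adjoint u) =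
      u.comp (ContinuousLinearMap.adjoint u) + u.comp (ContinuousLinearMap.adjoint u) := by
    rw [ContinuousLinearMap.mul_def, ContinuousLinearMap.comp_assoc,
      ← ContinuousLinearMap.comp_assoc _ u, hu]
    ext h
    simp
  have h : (1 - u.comp (ContinuousLinearMap.adjoint u) : H →L[ℂ] H) *
      (1 - u.comp (ContinuousLinearMap.adjoint u)) = 1 := by
    rw [sub_mul, mul_sub, mul_sub, hpp]
    simp
  rw [Unitary.mem_iff, hs]
  exact ⟨h, h⟩

/-- The reflection along `u = V₁ - V₂` exchanges two isometries with orthogonal ranges. The explicit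
formula for `W y` is what shows that `W` leaves an operator module containing `V₁` and `V₂`
invariant. -/
theorem exists_unitary_comp_eq {H : Type*} [NormedAddCommGroup H] [InnerProductSpace ℂ H]
    [CompleteSpace H] {V₁ V₂ : G →L[ℂ] H}
    (h11 : (ContinuousLinearMap.adjoint V₁).comp V₁ = 1)
    (h12 : (ContinuousLinearMap.adjoint V₁).comp V₂ = 0)
    (h21 : (ContinuousLinearMap.adjoint V₂).comp V₁ = 0)
    (h22 : (ContinuousLinearMap.adjoint V₂).comp V₂ = 1) :
    ∃ W : unitary (H →L[ℂ] H), star (W : H →L[ℂ] H) = W ∧ (W : H →L[ℂ] H).comp V₁ = V₂ ∧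
      (ContinuousLinearMap.adjoint V₁).comp (W : H →L[ℂ] H) = ContinuousLinearMap.adjoint V₂ ∧
      ∀ y : G →L[ℂ] H, (W : H →L[ℂ] H).comp y =
        y - (V₁ - V₂).comp ((ContinuousLinearMap.adjoint (V₁ - V₂)).comp y) := by
  have hu : (ContinuousLinearMap.adjoint (V₁ - V₂)).comp (V₁ - V₂) = 1 + 1 := by
    rw [map_sub, ContinuousLinearMap.sub_comp, ContinuousLinearMap.comp_sub,
      ContinuousLinearMap.comp_sub, h11, h12, h21, h22]
    abel
  have hs := (isSelfAdjoint_one_sub_comp_adjoint (V₁ - V₂)).star_eq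
  have hW : ∀ y : G →L[ℂ] H,
      (1 - (V₁ - V₂).comp (ContinuousLinearMap.adjoint (V₁ - V₂)) : H →L[ℂ] H).comp y =
      y - (V₁ - V₂).comp ((ContinuousLinearMap.adjoint (V₁ - V₂)).comp y) := fun y => by
    ext g
    simp
  have hWV : (1 - (V₁ - V₂).comp (ContinuousLinearMap.adjoint (V₁ - V₂)) : H →L[ℂ] H).comp V₁ =
      V₂ := by
    have h : (ContinuousLinearMap.adjoint (V₁ - V₂)).comp V₁ = 1 := by
      rw [map_sub, ContinuousLinearMap.sub_comp, h11, h21, sub_zero]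
    rw [hW, h]
    ext g
    simp
  refine ⟨⟨_, one_sub_mem_unitary hu⟩, hs, hWV, ?_, hW⟩
  have := congrArg ContinuousLinearMap.adjoint hWV
  rwa [ContinuousLinearMap.adjoint_comp, ← ContinuousLinearMap.star_eq_adjoint
    (1 - (V₁ - V₂).comp (ContinuousLinearMap.adjoint (V₁ - V₂)) : H →L[ℂ] H), hs] at this

theorem JointRep.nonempty_of_isOperatorModule (hι : Function.Injective ι) {φ₁ φ₂ : A →CP B}
    {H : Type u} [NormedAddCommGroup H] [InnerProductSpace ℂ H] [CompleteSpace H]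
    {S : Submodule ℂ (G →L[ℂ] H)} (hS : IsOperatorModule ι S)
    (hc : IsClosed (S : Set (G →L[ℂ] H))) {π₁ π₂ : A →⋆ₐ[ℂ] (H →L[ℂ] H)}
    (hπ₁ : ∀ a, ∀ x ∈ S, (π₁ a).comp x ∈ S) (hπ₂ : ∀ a, ∀ x ∈ S, (π₂ a).comp x ∈ S)
    {V : G →L[ℂ] H} (hV : V ∈ S) (hVV : (ContinuousLinearMap.adjoint V).comp V = 1)
    (h₁ : ∀ a, (ContinuousLinearMap.adjoint V).comp ((π₁ a).comp V) = ι (φ₁ a))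
    (h₂ : ∀ a, (ContinuousLinearMap.adjoint V).comp ((π₂ a).comp V) = ι (φ₂ a)) :
    Nonempty (JointRep φ₁ φ₂) := by
  have key : ∀ (π : A →⋆ₐ[ℂ] (H →L[ℂ] H)) (hπ : ∀ a, ∀ x ∈ S, (π a).comp x ∈ S) a,
      ι ((hS.hilbertModule hι hc).inn (hS.toElement hι hc V hV)
        (hS.leftRep hι hc π hπ a (hS.toElement hι hc V hV))) =
      (ContinuousLinearMap.adjoint V).comp ((π a).comp V) := fun π hπ a => by
    rw [hS.ι_inn, hS.toOperator_leftRep, hS.toOperator_toElement]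
  refine ⟨⟨hS.hilbertModule hι hc, hS.leftRep hι hc π₁ hπ₁, hS.leftRep hι hc π₂ hπ₂,
    hS.toElement hι hc V hV, hι ?_, fun a => hι ?_, fun a => hι ?_⟩⟩
  · rw [hS.ι_inn, hS.toOperator_toElement, hVV, map_one]
  · exact (h₁ a).symm.trans (key π₁ hπ₁ a).symm
  · exact (h₂ a).symm.trans (key π₂ hπ₂ a).symm

/-- On the direct sum of the two Stinespring dilations the cyclic isometries `V₁`, `V₂` have
orthogonal ranges. Conjugating the representation `π` by the reflection `W` that exchanges them
gives a second representation, and `V₁` then implements `φ₁` through `π` and `φ₂` through `W π W`.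
-/
theorem JointRep.nonempty (hι : Function.Injective ι) (hN : Set.range ι = (N : Set (G →L[ℂ] G)))
    (φ₁ φ₂ : A →CP B) (h₁ : φ₁ 1 = 1) (h₂ : φ₂ 1 = 1) : Nonempty (JointRep φ₁ φ₂) := by
  obtain ⟨D⟩ := (isPositiveKernel_sumKernel hι φ₁ φ₂).nonempty_dilation
  obtain ⟨π, hπL⟩ : ∃ π : A →⋆ₐ[ℂ] (D.H →L[ℂ] D.H), ∀ a x,
      (π a).comp (D.L x) = D.L (Sum.map (a * ·) (a * ·) x) :=
    ⟨D.act (isKernelAction_sumKernel ι φ₁ φ₂), fun a x =>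
      ContinuousLinearMap.ext fun g => D.act_L _ a x g⟩
  have h11 : (ContinuousLinearMap.adjoint (D.L (.inl 1))).comp (D.L (.inl 1)) = 1 := by
    simp [D.adjoint_comp, sumKernel, h₁]
  obtain ⟨W, hWs, hWV, hVW, hW⟩ := exists_unitary_comp_eq h11 (V₂ := D.L (.inr 1))
    (by simp [D.adjoint_comp, sumKernel]) (by simp [D.adjoint_comp, sumKernel])
    (by simp [D.adjoint_comp, sumKernel, h₂])
  obtain ⟨π₂, hπ₂⟩ : ∃ π₂ : A →⋆ₐ[ℂ] (D.H →L[ℂ] D.H), ∀ a,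
      π₂ a = (W : D.H →L[ℂ] D.H).comp ((π a).comp (W : D.H →L[ℂ] D.H)) := by
    refine ⟨(Unitary.conjStarAlgAut ℂ (D.H →L[ℂ] D.H) W).toStarAlgHom.comp π, fun a => ?_⟩
    change (W : D.H →L[ℂ] D.H) * π a * star (W : D.H →L[ℂ] D.H) = _
    rw [hWs]
    rfl
  have hπ₂V : ∀ a, (ContinuousLinearMap.adjoint (D.L (.inl 1))).comp
      ((π₂ a).comp (D.L (.inl 1))) =
      (ContinuousLinearMap.adjoint (D.L (.inr 1))).comp (D.L (.inr a)) := fun a => by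
    have hLa : D.L (.inr a) = (π a).comp (D.L (.inr 1)) := by
      rw [hπL, Sum.map_inr, mul_one]
    rw [hLa, ← hVW, hπ₂, ← hWV]
    rfl
  have hS₀ : IsOperatorModule ι (operatorSpan ι D.L) :=
    isOperatorModule_operatorSpan fun x y => ⟨_, (D.adjoint_comp x y).symm⟩
  have hS := hS₀.topologicalClosure hN
  have hc := (operatorSpan ι D.L).isClosed_topologicalClosure
  have hmem : ∀ x, D.L x ∈ operatorSpan ι D.L := mem_operatorSpan
  have hπS₀ : ∀ a, ∀ x ∈ operatorSpan ι D.L, (π a).comp x ∈ operatorSpan ι D.L := fun a _ hx =>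
    left_comp_mem_operatorSpan (fun x => by rw [hπL]; exact hmem _) hx
  -- In `W x = x - u (u⋆ x)` the factor `u⋆ x` lies in `ι B`, and the span is a right module over `ι
  -- B`.
  have hWS₀ : ∀ x ∈ operatorSpan ι D.L,
      (W : D.H →L[ℂ] D.H).comp x ∈ operatorSpan ι D.L := fun x hx => by
    have hu := sub_mem (hmem (.inl 1)) (hmem (.inr 1))
    obtain ⟨b, hb⟩ := hS₀.adjoint_comp_mem _ hu _ hx
    rw [hW, ← hb]
    exact sub_mem hx (hS₀.comp_mem _ hu b)
  have hπS := fun a => left_comp_mem_topologicalClosure (hπS₀ a)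
  have hπ₂S := fun a => left_comp_mem_topologicalClosure (T := π₂ a) fun x hx => by
    rw [hπ₂]
    exact hWS₀ _ (hπS₀ a _ (hWS₀ _ hx))
  have hV₁ := (operatorSpan ι D.L).le_topologicalClosure (hmem (.inl 1))
  refine JointRep.nonempty_of_isOperatorModule hι hS hc hπS hπ₂S (V := D.L (.inl 1)) hV₁ h11
    (fun a => ?_) fun a => ?_
  · rw [hπL, D.adjoint_comp]
    simp [sumKernel]
  · rw [hπ₂V, D.adjoint_comp]
    simp [sumKernel]

end JointRepresentation

/-! ### The cb norm and the vectors `∑ c x ⊙ g` of a Stinespring module. -/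

section CompletelyBounded

theorem cbNorm_le_ofReal_iff {A D H : Type u} [CStarAlgebra A] [PartialOrder A]
    [StarOrderedRing A] [CStarAlgebra D] [PartialOrder D] [StarOrderedRing D]
    [NormedAddCommGroup H] [InnerProductSpace ℂ H] [CompleteSpace H]
    {π : D →⋆ₐ[ℂ] (H →L[ℂ] H)} (hπ : Function.Injective π) (ψ : A →ₗ[ℂ] D) {r : ℝ} (hr : 0 ≤ r) :
    cbNorm ψ ≤ ENNReal.ofReal r ↔ ∀ (n : ℕ) (M : CStarMatrix (Fin n) (Fin n) A), ‖M‖ ≤ 1 →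
      ∀ h : Fin n → H, ∑ i, ‖∑ j, π (ψ (M i j)) (h j)‖ ^ 2 ≤ r ^ 2 * ∑ j, ‖h j‖ ^ 2 := by
  rw [cbNorm]
  simp only [iSup_le_iff]
  refine forall_congr' fun n => forall_congr' fun M => forall_congr' fun _ => ?_
  rw [← ofReal_norm, ENNReal.ofReal_le_ofReal_iff hr, CStarMatrix.norm_le_iff hπ _ hr]
  rfl

end CompletelyBounded

namespace StinespringModule

set_option linter.unusedSectionVars false

variable {C B G : Type u} [CStarAlgebra C] [PartialOrder C] [StarOrderedRing C]
  [CStarAlgebra B] [PartialOrder B] [StarOrderedRing B]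
  [NormedAddCommGroup G] [InnerProductSpace ℂ G] [CompleteSpace G]
  {ι : B →⋆ₐ[ℂ] (G →L[ℂ] G)} {φ : C →CP B} (D : StinespringModule φ) (T : InteriorTensor ι D.E)

/-- The vector `∑ c x ⊙ g` of `E ⊙ G`. -/
noncomputable def vector : (C →₀ G) →ₗ[ℂ] T.H :=
  Finsupp.lsum ℂ fun c => (T.L (D.σ c D.x)).toLinearMap

theorem vector_apply (f : C →₀ G) : D.vector T f = f.sum fun c g => T.L (D.σ c D.x) g := rfl

theorem vector_single (c : C) (g : G) :
    D.vector T (Finsupp.single c g) = T.L (D.σ c D.x) g := by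
  simp [vector_apply]

theorem inn_σ (c d : C) : D.E.inn (D.σ c D.x) (D.σ d D.x) = φ (star c * d) := by
  rw [D.eq, map_mul, map_star, HilbertModule.Adjointable.mul_apply,
    HilbertModule.Adjointable.inn_star_right]

/-- The norms of these vectors depend on `φ` only, not on the module. -/
theorem norm_vector_sq (f : C →₀ G) :
    ‖D.vector T f‖ ^ 2 = (kernelForm (fun c d : C => ι (φ (star c * d))) f).re := by
  rw [← inner_self_eq_norm_sq (𝕜 := ℂ)]
  refine congrArg Complex.re ?_
  simp only [vector_apply, kernelForm, Finsupp.sum, sum_inner, inner_sum, T.inner_L_L, inn_σ]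
  exact Finset.sum_comm

theorem adjointableRep_vector (c : C) (f : C →₀ G) :
    T.adjointableRep (D.σ c) (D.vector T f) = D.vector T (f.mapDomain (c * ·)) := by
  rw [vector_apply, vector_apply, Finsupp.sum_mapDomain_index (by simp) (by simp), Finsupp.sum,
    map_sum]
  refine Finset.sum_congr rfl fun d _ => ?_
  change _ = T.L (D.σ (c * d) D.x) (f d)
  rw [T.adjointableRep_L, map_mul, HilbertModule.Adjointable.mul_apply]

end StinespringModule

namespace InteriorTensor

set_option linter.unusedSectionVars false

variable {B G : Type u} [CStarAlgebra B] [PartialOrder B] [StarOrderedRing B]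
  [NormedAddCommGroup G] [InnerProductSpace ℂ G] [CompleteSpace G]
  {ι : B →⋆ₐ[ℂ] (G →L[ℂ] G)} {E : HilbertModule B} (T : InteriorTensor ι E)

theorem L_rsmul (x : E) (b : B) (g : G) : T.L (E.rsmul x b) g = T.L x (ι b g) :=
  T.toKernelDilation.ext_inner_L fun z h => by
    change ⟪T.L z h, _⟫_ℂ = ⟪T.L z h, _⟫_ℂ
    rw [T.inner_L_L, T.inner_L_L, HilbertModule.inn_rsmul, map_mul]
    rfl

theorem norm_L_apply_le (x : E) (g : G) : ‖T.L x g‖ ≤ ‖g‖ * ‖x‖ := by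
  refine le_of_sq_le_sq ?_ (by positivity)
  have h1 : ‖T.L x g‖ ^ 2 = ‖⟪g, ι (E.inn x x) g⟫_ℂ‖ := by
    rw [← T.inner_L_L, inner_self_eq_norm_sq_to_K]
    simp
  rw [h1, mul_pow]
  calc ‖⟪g, ι (E.inn x x) g⟫_ℂ‖ ≤ ‖g‖ * ‖ι (E.inn x x) g‖ := norm_inner_le_norm _ _
    _ ≤ ‖g‖ * (‖E.inn x x‖ * ‖g‖) := by
        gcongr
        exact ((ι (E.inn x x)).le_opNorm g).trans (mul_le_mul_of_nonneg_right
          (NonUnitalStarAlgHom.norm_apply_le ι _) (norm_nonneg _))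
    _ = ‖g‖ ^ 2 * ‖x‖ ^ 2 := by rw [HilbertModule.norm_sq_eq]; ring

theorem continuous_L_apply (g : G) : Continuous fun x : E => T.L x g :=
  AddMonoidHomClass.continuous_of_bound
    ((ContinuousLinearMap.apply ℂ T.H g).toLinearMap ∘ₗ T.L) ‖g‖ fun x => T.norm_L_apply_le x g

end InteriorTensor

namespace StinespringModule

set_option linter.unusedSectionVars false

variable {C B G : Type u} [CStarAlgebra C] [PartialOrder C] [StarOrderedRing C]
  [CStarAlgebra B] [PartialOrder B] [StarOrderedRing B]
  [NormedAddCommGroup G] [InnerProductSpace ℂ G] [CompleteSpace G]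
  {ι : B →⋆ₐ[ℂ] (G →L[ℂ] G)} {φ : C →CP B} (D : StinespringModule φ) (T : InteriorTensor ι D.E)

theorem L_mem_range_vector {y : D.E} (hy : y ∈ D.spanCxB) (g : G) :
    T.L y g ∈ LinearMap.range (D.vector T) := by
  rw [spanCxB] at hy
  induction hy using Submodule.span_induction with
  | mem y hy =>
    obtain ⟨c, b, rfl⟩ := hy
    exact ⟨Finsupp.single c (ι b g), by rw [vector_single, T.L_rsmul]⟩
  | zero => rw [map_zero]; exact zero_mem _
  | add y z _ _ hy hz => rw [map_add]; exact add_mem hy hz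
  | smul r y _ hy => rw [map_smul]; exact Submodule.smul_mem _ r hy

/-- The hypothesis asks for approximation of `y ⊙ g` for one `g` at a time, which both norm density
and strong density of the span of `C x B` provide. The span itself contributes nothing new, since `c
x b ⊙ g = c x ⊙ b g`. -/
theorem denseRange_vector (h : ∀ y g, T.L y g ∈ closure {u | ∃ z ∈ D.spanCxB, T.L z g = u}) :
    DenseRange (D.vector T) := by
  have hd : (LinearMap.range (D.vector T)).topologicalClosure = ⊤ := by
    refine top_le_iff.1 (T.dense.ge.trans (Submodule.topologicalClosure_minimal _
      (Submodule.span_le.2 ?_) (Submodule.isClosed_topologicalClosure _)))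
    rintro _ ⟨y, g, rfl⟩
    refine closure_mono ?_ (h y g)
    rintro _ ⟨z, hz, rfl⟩
    exact D.L_mem_range_vector T hz g
  exact Submodule.dense_iff_topologicalClosure_eq_top.2 hd

theorem IsMinimal.denseRange_vector {D : StinespringModule φ} (hD : D.IsMinimal)
    (T : InteriorTensor ι D.E) : DenseRange (D.vector T) := by
  refine D.denseRange_vector T fun y g => ?_
  have hy : y ∈ closure (D.spanCxB : Set D.E) :=
    (Submodule.dense_iff_topologicalClosure_eq_top.2 hD) y
  exact map_mem_closure (f := fun x => T.L x g) (T.continuous_L_apply g) hy fun z hz => ⟨z, hz, rfl⟩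

theorem IsStronglyMinimal.exists_denseRange_vector {D : StinespringModule φ}
    (hD : D.IsStronglyMinimal ι) : ∃ T : InteriorTensor ι D.E, DenseRange (D.vector T) := by
  obtain ⟨-, T, hT⟩ := hD
  refine ⟨T, D.denseRange_vector T fun y g => ?_⟩
  have hc : Continuous fun S : G →Lₚₜ[ℂ] T.H => S g :=
    continuous_eval_const g
  exact map_mem_closure (f := fun S : G →Lₚₜ[ℂ] T.H => S g) hc (hT ⟨y, trivial, rfl⟩) (by
    rintro _ ⟨z, hz, rfl⟩
    exact ⟨z, hz, rfl⟩)

end StinespringModule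

/-! ### A criterion for the cb distance in terms of the coupling alone. -/

section Criterion

set_option linter.unusedSectionVars false

variable {A B G : Type u} [CStarAlgebra A] [PartialOrder A] [StarOrderedRing A]
  [CStarAlgebra B] [PartialOrder B] [StarOrderedRing B]
  [NormedAddCommGroup G] [InnerProductSpace ℂ G] [CompleteSpace G]

/-- The inequality `‖σ₁ - σ₂‖_cb ≤ r` for the representations given by `φ`, tested on finite sums
of elementary vectors. -/
def CompletelyPositiveMap.CbDistLE (ι : B →⋆ₐ[ℂ] (G →L[ℂ] G)) (φ : FullFreeProduct A →CP B)
    (r : ℝ) : Prop :=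
  ∀ (n : ℕ) (M : CStarMatrix (Fin n) (Fin n) A), ‖M‖ ≤ 1 →
    ∀ f : Fin n → (FullFreeProduct A →₀ G),
      ∑ i, (kernelForm (fun c d => ι (φ (star c * d))) (∑ j, (f j).mapDomain
        ((FullFreeProduct.ρ 0 (M i j) - FullFreeProduct.ρ 1 (M i j)) * ·))).re ≤
      r ^ 2 * ∑ j, (kernelForm (fun c d => ι (φ (star c * d))) (f j)).re

variable {ι : B →⋆ₐ[ℂ] (G →L[ℂ] G)} {φ : FullFreeProduct A →CP B} {D : StinespringModule φ}

theorem StinespringModule.cbDist_le_ofReal_iff (hι : Function.Injective ι)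
    (T : InteriorTensor ι D.E) {r : ℝ} (hr : 0 ≤ r) :
    D.cbDist ≤ ENNReal.ofReal r ↔ ∀ (n : ℕ) (M : CStarMatrix (Fin n) (Fin n) A), ‖M‖ ≤ 1 →
      ∀ h : Fin n → T.H, ∑ i, ‖∑ j, T.adjointableRep (D.σ
        (FullFreeProduct.ρ 0 (M i j) - FullFreeProduct.ρ 1 (M i j))) (h j)‖ ^ 2 ≤
          r ^ 2 * ∑ j, ‖h j‖ ^ 2 := by
  rw [StinespringModule.cbDist, _root_.cbDist,
    cbNorm_le_ofReal_iff (T.adjointableRep_injective hι) _ hr]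
  have e : ∀ a, (((D.σ.comp (FullFreeProduct.ρ 0)).toAlgHom.toLinearMap -
      (D.σ.comp (FullFreeProduct.ρ 1)).toAlgHom.toLinearMap) a) =
        D.σ (FullFreeProduct.ρ 0 a - FullFreeProduct.ρ 1 a) := fun a => (map_sub D.σ _ _).symm
  simp only [e]

/-- Left multiplication on indices implements `σ` on the vectors, and their norms are kernel forms
of `φ`. -/
theorem CompletelyPositiveMap.cbDistLE_iff (T : InteriorTensor ι D.E) (r : ℝ) :
    φ.CbDistLE ι r ↔ ∀ (n : ℕ) (M : CStarMatrix (Fin n) (Fin n) A), ‖M‖ ≤ 1 →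
      ∀ f : Fin n → (FullFreeProduct A →₀ G), ∑ i, ‖∑ j, T.adjointableRep (D.σ
        (FullFreeProduct.ρ 0 (M i j) - FullFreeProduct.ρ 1 (M i j))) (D.vector T (f j))‖ ^ 2 ≤
          r ^ 2 * ∑ j, ‖D.vector T (f j)‖ ^ 2 := by
  simp only [D.adjointableRep_vector, ← map_sum, D.norm_vector_sq]
  rfl

theorem StinespringModule.cbDistLE (hι : Function.Injective ι) {r : ℝ} (hr : 0 ≤ r)
    (h : D.cbDist ≤ ENNReal.ofReal r) : φ.CbDistLE ι r := by
  obtain ⟨T⟩ := InteriorTensor.nonempty hι D.E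
  rw [StinespringModule.cbDist_le_ofReal_iff hι T hr] at h
  exact (CompletelyPositiveMap.cbDistLE_iff T r).2 fun n M hM f => h n M hM _

/-- Both sides of the inequality are continuous in the tuple of vectors, so a dense set of vectors
suffices. -/
theorem CompletelyPositiveMap.CbDistLE.cbDist_le (hι : Function.Injective ι) {r : ℝ} (hr : 0 ≤ r)
    (h : φ.CbDistLE ι r) {T : InteriorTensor ι D.E} (hT : DenseRange (D.vector T)) :
    D.cbDist ≤ ENNReal.ofReal r := by
  rw [StinespringModule.cbDist_le_ofReal_iff hι T hr]
  rw [CompletelyPositiveMap.cbDistLE_iff T] at h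
  intro n M hM u
  have hd : DenseRange fun (f : Fin n → (FullFreeProduct A →₀ G)) j => D.vector T (f j) :=
    DenseRange.piMap fun _ => hT
  exact hd.induction_on u (isClosed_le (by fun_prop) (by fun_prop)) (h n M hM)

end Criterion

/-! ### Point-weak limits of completely positive maps. -/

section WeakLimits

open Filter Topology

set_option linter.unusedSectionVars false

/-- Each matrix coefficient stays in a compact disc and converges along the ultrafilter. The limits
form a bounded sesquilinear form, which comes from an operator. -/
theorem ContinuousLinearMap.exists_tendsto_inner {G : Type*} [NormedAddCommGroup G]
    [InnerProductSpace ℂ G] [CompleteSpace G] {α : Type*} (U : Ultrafilter α)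
    (T : α → G →L[ℂ] G) {κ : ℝ} (hT : ∀ n, ‖T n‖ ≤ κ) :
    ∃ S : G →L[ℂ] G, ∀ g h, Tendsto (fun n => ⟪g, T n h⟫_ℂ) U (𝓝 ⟪g, S h⟫_ℂ) := by
  have hb : ∀ g h n, ‖⟪g, T n h⟫_ℂ‖ ≤ κ * ‖g‖ * ‖h‖ := fun g h n =>
    calc ‖⟪g, T n h⟫_ℂ‖ ≤ ‖g‖ * ‖T n h‖ := norm_inner_le_norm _ _
      _ ≤ ‖g‖ * (κ * ‖h‖) := by
          gcongr
          exact ((T n).le_opNorm h).trans (mul_le_mul_of_nonneg_right (hT n) (norm_nonneg _))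
      _ = κ * ‖g‖ * ‖h‖ := by ring
  have hlim : ∀ g h, ∃ z : ℂ, Tendsto (fun n => ⟪g, T n h⟫_ℂ) U (𝓝 z) := fun g h => by
    obtain ⟨z, -, hz⟩ := (isCompact_closedBall (0 : ℂ) (κ * ‖g‖ * ‖h‖)).ultrafilter_le_nhds
      (U.map fun n => ⟪g, T n h⟫_ℂ) (le_principal_iff.2 <| mem_map.2 <| Filter.univ_mem' fun n =>
        mem_closedBall_zero_iff.2 (hb g h n))
    exact ⟨z, hz⟩
  choose ℓ hℓ using hlim
  let b : G →ₗ⋆[ℂ] G →ₗ[ℂ] ℂ := LinearMap.mk₂'ₛₗ (starRingEnd ℂ) (RingHom.id ℂ) ℓ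
    (fun g g' h => tendsto_nhds_unique (hℓ _ _) (by
      simpa only [inner_add_left] using (hℓ g h).add (hℓ g' h)))
    (fun r g h => tendsto_nhds_unique (hℓ _ _) (by
      simpa only [inner_smul_left, smul_eq_mul] using (hℓ g h).const_mul (starRingEnd ℂ r)))
    (fun g h h' => tendsto_nhds_unique (hℓ _ _) (by
      simpa only [map_add, inner_add_right] using (hℓ g h).add (hℓ g h')))
    (fun r g h => tendsto_nhds_unique (hℓ _ _) (by
      simpa only [map_smul, inner_smul_right, RingHom.id_apply, smul_eq_mul] using (hℓ g h).const_mul r))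
  let S := InnerProductSpace.continuousLinearMapOfBilin (b.mkContinuous₂ κ fun g h =>
    le_of_tendsto (hℓ g h).norm (Eventually.of_forall (hb g h)))
  -- The representing operator `S` sits in the first slot, `⟪S g, h⟫`; its adjoint moves it to the
  -- second.
  refine ⟨ContinuousLinearMap.adjoint S, fun g h => ?_⟩
  rw [ContinuousLinearMap.adjoint_inner_right,
    InnerProductSpace.continuousLinearMapOfBilin_apply]
  exact hℓ g h

variable {C B G : Type u} [CStarAlgebra C] [PartialOrder C] [StarOrderedRing C]
  [CStarAlgebra B] [PartialOrder B] [StarOrderedRing B]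
  [NormedAddCommGroup G] [InnerProductSpace ℂ G] [CompleteSpace G]
  {ι : B →⋆ₐ[ℂ] (G →L[ℂ] G)} {N : VonNeumannAlgebra G}

theorem tendsto_kernelForm {X : Type u} {α : Type*} {l : Filter α} {K : α → X → X → G →L[ℂ] G}
    {K' : X → X → G →L[ℂ] G}
    (h : ∀ x y v w, Tendsto (fun n => ⟪v, K n x y w⟫_ℂ) l (𝓝 ⟪v, K' x y w⟫_ℂ)) (f : X →₀ G) :
    Tendsto (fun n => kernelForm (K n) f) l (𝓝 (kernelForm K' f)) :=
  tendsto_finsetSum _ fun x _ => tendsto_finsetSum _ fun y _ => h x y _ _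

/-- Pointwise limits exist by boundedness and stay in `N`, which is weakly closed. Complete
positivity passes to the limit because each kernel form is a finite sum of matrix coefficients. -/
theorem CompletelyPositiveMap.exists_tendsto_inner (hι : Function.Injective ι)
    (hN : Set.range ι = (N : Set (G →L[ℂ] G))) {α : Type*} (U : Ultrafilter α)
    (φ : α → C →CP B) {κ : ℝ} (hφ : ∀ n c, ‖φ n c‖ ≤ κ * ‖c‖) :
    ∃ ψ : C →CP B, ∀ c g h,
      Tendsto (fun n => ⟪g, ι (φ n c) h⟫_ℂ) U (𝓝 ⟪g, ι (ψ c) h⟫_ℂ) := by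
  have hlim : ∀ c, ∃ b : B, ∀ g h,
      Tendsto (fun n => ⟪g, ι (φ n c) h⟫_ℂ) U (𝓝 ⟪g, ι b h⟫_ℂ) := fun c => by
    obtain ⟨S, hS⟩ := ContinuousLinearMap.exists_tendsto_inner U (fun n => ι (φ n c))
      fun n => (NonUnitalStarAlgHom.norm_apply_le ι _).trans (hφ n c)
    obtain ⟨b, rfl⟩ : S ∈ Set.range ι := by
      rw [hN]
      refine VonNeumannAlgebra.mem_iff_inner.2 fun t ht g h => ?_
      refine tendsto_nhds_unique (hS h (t g)) ?_
      have hmem : ∀ n, ι (φ n c) ∈ N := fun n => by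
        rw [← SetLike.mem_coe, ← hN]
        exact Set.mem_range_self _
      simpa only [fun n => VonNeumannAlgebra.mem_iff_inner.1 (hmem n) t ht g h] using
        hS (ContinuousLinearMap.adjoint t h) g
    exact ⟨b, hS⟩
  choose ℓ hℓ using hlim
  have hext : ∀ {b b' : B}, (∀ g h, ⟪g, ι b h⟫_ℂ = ⟪g, ι b' h⟫_ℂ) → b = b' := fun h =>
    hι (ContinuousLinearMap.ext fun v => ext_inner_left ℂ fun g => h g v)
  let ψ : C →ₗ[ℂ] B :=
    { toFun := ℓ
      map_add' := fun c d => hext fun g h => tendsto_nhds_unique (hℓ _ g h) (by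
        simpa only [map_add, _root_.add_apply, inner_add_right] using (hℓ c g h).add (hℓ d g h))
      map_smul' := fun r c => hext fun g h => tendsto_nhds_unique (hℓ _ g h) (by
        simpa only [map_smul, _root_.smul_apply, inner_smul_right, RingHom.id_apply] using
          (hℓ c g h).const_mul r) }
  refine ⟨CompletelyPositiveMap.ofKernelForm hι ψ fun f => ?_, hℓ⟩
  exact ge_of_tendsto (tendsto_kernelForm (fun c d v w => hℓ (star c * d) v w) f)
    (Eventually.of_forall fun n => ((φ n).isPositiveKernel hι).zero_le_form f)

end WeakLimits

/-! ### Passage to the limit along a minimizing sequence. -/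

section Attainment

open Filter Topology

set_option linter.unusedSectionVars false

variable {A B G : Type u} [CStarAlgebra A] [PartialOrder A] [StarOrderedRing A]
  [CStarAlgebra B] [PartialOrder B] [StarOrderedRing B]
  [NormedAddCommGroup G] [InnerProductSpace ℂ G] [CompleteSpace G]
  {ι : B →⋆ₐ[ℂ] (G →L[ℂ] G)} {N : VonNeumannAlgebra G} {φ₁ φ₂ : A →CP B}

/-- Cauchy-Schwarz in the module, with `‖x‖² = ‖φ 1‖`. Couplings share the value `φ 1 = φ₁ 1`, so
the bound is uniform over them. -/
theorem StinespringModule.norm_apply_le {C : Type u} [CStarAlgebra C] [PartialOrder C]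
    [StarOrderedRing C] {φ : C →CP B} (D : StinespringModule φ) (c : C) :
    ‖φ c‖ ≤ ‖φ 1‖ * ‖c‖ := by
  have h1 : ‖φ 1‖ = ‖D.x‖ ^ 2 := by
    rw [HilbertModule.norm_sq_eq, D.eq, map_one]
    rfl
  calc ‖φ c‖ ≤ ‖D.x‖ * ‖D.σ c D.x‖ := by
        rw [D.eq]
        exact HilbertModule.norm_inn_le _ _
    _ ≤ ‖D.x‖ * (‖c‖ * ‖D.x‖) := by
        gcongr
        exact ((D.σ c).toCLM.le_opNorm _).trans (mul_le_mul_of_nonneg_right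
          (NonUnitalStarAlgHom.norm_apply_le D.σ c) (norm_nonneg _))
    _ = ‖φ 1‖ * ‖c‖ := by rw [h1]; ring

theorem couplings.apply_one {φ : FullFreeProduct A →CP B} (hφ : φ ∈ couplings φ₁ φ₂) :
    φ 1 = φ₁ 1 := by
  rw [← hφ.1, map_one (FullFreeProduct.ρ 0)]

/-- The two actions combine to a representation of the free product, and the coupling is its vector
map at `x`. -/
theorem JointRep.exists_coupling (hι : Function.Injective ι) (t : JointRep φ₁ φ₂) :
    ∃ φ ∈ couplings φ₁ φ₂, ∃ D : StinespringModule φ, D.cbDist = cbDist t.σ₁ t.σ₂ := by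
  obtain ⟨T⟩ := InteriorTensor.nonempty hι t.E
  obtain ⟨σ, hσ⟩ := FullFreeProduct.exists_lift (T.adjointableRep_injective hι) ![t.σ₁, t.σ₂]
  obtain ⟨φ, hφ⟩ := HilbertModule.exists_completelyPositive hι σ t.x
  have h0 : ∀ a, σ (FullFreeProduct.ρ 0 a) = t.σ₁ a := hσ 0
  have h1 : ∀ a, σ (FullFreeProduct.ρ 1 a) = t.σ₂ a := hσ 1
  refine ⟨φ, ⟨fun a => ?_, fun a => ?_⟩, ⟨t.E, σ, t.x, hφ⟩, ?_⟩
  · rw [hφ, h0, t.eq₁]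
  · rw [hφ, h1, t.eq₂]
  · exact congrArg₂ cbDist (StarAlgHom.ext h0) (StarAlgHom.ext h1)

theorem StinespringModule.gammaDist_le_cbDist (h₁ : φ₁ 1 = 1) {φ : FullFreeProduct A →CP B}
    (hφ : φ ∈ couplings φ₁ φ₂) (D : StinespringModule φ) : gammaDist φ₁ φ₂ ≤ D.cbDist := by
  refine iInf_le (fun t : JointRep φ₁ φ₂ => _root_.cbDist t.σ₁ t.σ₂)
    ⟨D.E, D.σ.comp (FullFreeProduct.ρ 0), D.σ.comp (FullFreeProduct.ρ 1), D.x, ?_,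
      fun a => (hφ.1 a).symm.trans (D.eq _), fun a => (hφ.2 a).symm.trans (D.eq _)⟩
  rw [← h₁, ← couplings.apply_one hφ, D.eq, map_one]
  rfl

/-- For fixed test data the criterion is a non-strict inequality between finite sums of kernel
forms, hence closed under weak limits. -/
theorem CompletelyPositiveMap.CbDistLE.of_tendsto {α : Type*} {l : Filter α} [l.NeBot]
    {φ : α → FullFreeProduct A →CP B} {ψ : FullFreeProduct A →CP B}
    (h : ∀ c g h, Tendsto (fun n => ⟪g, ι (φ n c) h⟫_ℂ) l (𝓝 ⟪g, ι (ψ c) h⟫_ℂ)) {r : ℝ}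
    (hφ : ∀ᶠ n in l, (φ n).CbDistLE ι r) : ψ.CbDistLE ι r := by
  intro n M hM f
  have hk : ∀ f : FullFreeProduct A →₀ G, Tendsto
      (fun n => (kernelForm (fun c d => ι (φ n (star c * d))) f).re) l
      (𝓝 (kernelForm (fun c d => ι (ψ (star c * d))) f).re) := fun f =>
    (Complex.continuous_re.tendsto _).comp
      (tendsto_kernelForm (fun c d v w => h (star c * d) v w) f)
  exact le_of_tendsto_of_tendsto (tendsto_finsetSum _ fun i _ => hk _)
    ((tendsto_finsetSum _ fun i _ => hk _).const_mul _) (hφ.mono fun k hk => hk n M hM f)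

theorem couplings.of_tendsto (hι : Function.Injective ι) {α : Type*} {l : Filter α} [l.NeBot]
    {φ : α → FullFreeProduct A →CP B} {ψ : FullFreeProduct A →CP B}
    (h : ∀ c g h, Tendsto (fun n => ⟪g, ι (φ n c) h⟫_ℂ) l (𝓝 ⟪g, ι (ψ c) h⟫_ℂ))
    (hφ : ∀ n, φ n ∈ couplings φ₁ φ₂) : ψ ∈ couplings φ₁ φ₂ := by
  have hext : ∀ {b b' : B}, (∀ g h, ⟪g, ι b h⟫_ℂ = ⟪g, ι b' h⟫_ℂ) → b = b' := fun h =>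
    hι (ContinuousLinearMap.ext fun v => ext_inner_left ℂ fun g => h g v)
  refine ⟨fun a => hext fun g k => ?_, fun a => hext fun g k => ?_⟩
  · exact tendsto_nhds_unique (h _ g k) (tendsto_const_nhds.congr fun n => by rw [(hφ n).1 a])
  · exact tendsto_nhds_unique (h _ g k) (tendsto_const_nhds.congr fun n => by rw [(hφ n).2 a])

theorem exists_coupling_cbDistLE (hι : Function.Injective ι)
    (hN : Set.range ι = (N : Set (G →L[ℂ] G))) (h₁ : φ₁ 1 = 1) (h₂ : φ₂ 1 = 1) :
    ∃ φ ∈ couplings φ₁ φ₂, ∀ r : ℝ, 0 ≤ r → gammaDist φ₁ φ₂ < ENNReal.ofReal r →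
      φ.CbDistLE ι r := by
  have := JointRep.nonempty hι hN φ₁ φ₂ h₁ h₂
  obtain ⟨u, -, hu, hmem⟩ := exists_seq_tendsto_sInf
    (Set.range_nonempty fun t : JointRep φ₁ φ₂ => cbDist t.σ₁ t.σ₂) (OrderBot.bddBelow _)
  choose t ht using hmem
  choose φ hφ D hD using fun n => (t n).exists_coupling hι
  obtain ⟨ψ, hψ⟩ := CompletelyPositiveMap.exists_tendsto_inner hι hN (hyperfilter ℕ) φ
    (κ := ‖φ₁ 1‖) fun n c => by
      rw [← couplings.apply_one (hφ n)]
      exact (D n).norm_apply_le c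
  refine ⟨ψ, couplings.of_tendsto hι hψ hφ, fun r hr hlt =>
    CompletelyPositiveMap.CbDistLE.of_tendsto hψ ?_⟩
  -- The strict inequality `γ < r` puts the minimizing sequence eventually below `r`, and the free
  -- ultrafilter refines `atTop`.
  filter_upwards [Nat.hyperfilter_le_atTop (hu.eventually_lt_const hlt)] with n hn
  refine (D n).cbDistLE hι hr ?_
  rw [hD, show cbDist (t n).σ₁ (t n).σ₂ = u n from ht n]
  exact hn.le

theorem StinespringModule.gammaDist_eq_cbDist (hι : Function.Injective ι) (h₁ : φ₁ 1 = 1)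
    {φ : FullFreeProduct A →CP B} (hφ : φ ∈ couplings φ₁ φ₂)
    (hle : ∀ r : ℝ, 0 ≤ r → gammaDist φ₁ φ₂ < ENNReal.ofReal r → φ.CbDistLE ι r)
    (D : StinespringModule φ) {T : InteriorTensor ι D.E} (hT : DenseRange (D.vector T)) :
    gammaDist φ₁ φ₂ = D.cbDist := by
  refine le_antisymm (D.gammaDist_le_cbDist h₁ hφ) (le_of_forall_gt fun s hs => ?_)
  -- The criterion is stated for real bounds, so a real `r` is inserted between `γ` and `s`.
  obtain ⟨r, hr, hγr, hrs⟩ := ENNReal.lt_iff_exists_real_btwn.1 hs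
  exact ((hle r hr hγr).cbDist_le hι hr hT).trans_lt hrs

end Attainment

theorem mainTheorem4 {A B G : Type u}
    [CStarAlgebra A] [PartialOrder A] [StarOrderedRing A]
    [CStarAlgebra B] [PartialOrder B] [StarOrderedRing B]
    [NormedAddCommGroup G] [InnerProductSpace ℂ G] [CompleteSpace G]
    -- `B` is a von Neumann algebra, faithfully embedded in `𝓑(G)` by `ι`
    (N : VonNeumannAlgebra G) (ι : B →⋆ₐ[ℂ] (G →L[ℂ] G))
    (hι : Function.Injective ι) (hN : Set.range ι = (N : Set (G →L[ℂ] G)))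
    -- `φ₁` and `φ₂` are unital completely positive maps
    (φ₁ φ₂ : A →CP B) (h₁ : φ₁ 1 = 1) (h₂ : φ₂ 1 = 1) :
    ∃ φ ∈ couplings φ₁ φ₂,
      -- the minimal Stinespring von Neumann module of `φ`
      ((∃ D : StinespringModule φ, D.IsStronglyMinimal ι) ∧
        ∀ D : StinespringModule φ, D.IsStronglyMinimal ι → gammaDist φ₁ φ₂ = D.cbDist) ∧
      -- the minimal Stinespring Hilbert module of `φ`
      ((∃ D : StinespringModule φ, D.IsMinimal) ∧
        ∀ D : StinespringModule φ, D.IsMinimal → gammaDist φ₁ φ₂ = D.cbDist) := by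
  obtain ⟨φ, hφ, hle⟩ := exists_coupling_cbDistLE hι hN h₁ h₂
  refine ⟨φ, hφ, ⟨φ.exists_isStronglyMinimal hι hN, fun D hD => ?_⟩,
    φ.exists_isMinimal hι hN, fun D hD => ?_⟩
  · obtain ⟨T, hT⟩ := hD.exists_denseRange_vector
    exact D.gammaDist_eq_cbDist hι h₁ hφ hle hT
  · obtain ⟨T⟩ := InteriorTensor.nonempty hι D.E
    exact D.gammaDist_eq_cbDist hι h₁ hφ hle (hD.denseRange_vector T)
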